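/- A multimatrix is a tuple $E=(E_1,\dots,E_n)$, $n\ge 1$, of invertible complex matrices $E_\lambda\in GL_{d_\lambda}(\mathbb{C})$ with block sizes $0<d_1\le\dots\le d_n$. Put $E^{-1}=(E_1^{-1},\dots,E_n^{-1})$ and $\mathrm{Tr}(E)=\sum_{\lambda=1}^n \mathrm{tr}(E_\lambda)$, where $\mathrm{tr}$ is the usual trace. Write $E_{ij,\lambda}$ and $E^{-1}_{ij,\lambda}$ for the $(i,j)$ entries of $E_\lambda$ and $E_\lambda^{-1}$. Let $E$ and $F$ be multimatrices with block sizes $d^E_1\le\dots\le d^E_{n_E}$ and $d^F_1\le\dots\le d^F_{n_F}$. Let $\mathcal{A}(E,F)$ be the universal unital associative $\mathbb{C}$-algebra with generators $X_{kl,\mu}^{ij,\lambda}$ ($1\le\lambda\le n_E$, $1\le i,j\le d^E_\lambda$, $1\le\mu\le n_F$, $1\le k,l\le d^F_\mu$) and the following relations, for all admissible values of the free indices (lower indices belong to the blocks of $F$ and upper indices to the blocks of $E$): $$\sum_{q=1}^{d^E_\nu} X_{ij,\lambda}^{rq,\nu}X_{kl,\mu}^{qs,\nu}=\delta_{\lambda\mu}\delta_{jk}X_{il,\mu}^{rs,\nu},\qquad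 \sum_{\mu=1}^{n_F}\sum_{k=1}^{d^F_\mu}X_{kk,\mu}^{ij,\lambda}=\delta_{ij},$$ $$\sum_{\mu=1}^{n_E}\sum_{k,l=1}^{d^E_\mu}E^{-1}_{kl,\mu}X_{ij,\lambda}^{kl,\mu}=F^{-1}_{ij,\lambda},\qquad \sum_{r,s=1}^{d^F_\mu}F_{rs,\mu}X_{kr,\mu}^{ip,\lambda}X_{sl,\mu}^{qj,\nu}=\delta_{\lambda\nu}E_{pq,\lambda}X_{kl,\mu}^{ij,\lambda}.$$ Assume that the largest block sizes satisfy $d^E_{n_E}>1$ and $d^F_{n_F}>1$, that $\mathrm{Tr}(E^{-1})=\mathrm{Tr}(F^{-1})$, and that $\mathrm{tr}(E_\lambda)=\mathrm{tr}(F_\mu)$ for all $1\le\lambda\le n_E$ and $1\le\mu\le n_F$. Then the algebra $\mathcal{A}(E,F)$ is nonzero. -/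

import Mathlib

open scoped MatrixGroups

noncomputable section

/-- A nonempty nondecreasing list `0 < d 1 ≤ ⋯ ≤ d n` of block sizes. -/
structure BlockSizes where
  n : ℕ
  n_pos : 0 < n
  d : Fin n → ℕ
  d_pos : ∀ a, 0 < d a
  d_mono : Monotone d

/-- The last, hence largest, block size. -/
def BlockSizes.largest (D : BlockSizes) : ℕ :=
  D.d ⟨D.n - 1, Nat.sub_lt D.n_pos Nat.one_pos⟩

/-- Multimatrices with block sizes `D`: tuples of invertible complex matrices. The inverse `E⁻¹` is
taken block by block. -/
abbrev Multimatrix (D : BlockSizes) : Type :=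
  ∀ a : Fin D.n, GL (Fin (D.d a)) ℂ

/-- The total trace: the sum of the traces of the blocks. -/
def Multimatrix.Tr {D : BlockSizes} (E : Multimatrix D) : ℂ :=
  ∑ a, (E a : Matrix (Fin (D.d a)) (Fin (D.d a)) ℂ).trace

/-- Labels of the generators: `⟨a, i, j, b, k, l⟩` with `a` a block of the first list and `i`, `j`
indices in it, and `b` a block of the second list and `k`, `l` indices in it. -/
structure GenLabel (D D' : BlockSizes) : Type where
  a : Fin D.n
  i : Fin (D.d a)
  j : Fin (D.d a)
  b : Fin D'.n
  k : Fin (D'.d b)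
  l : Fin (D'.d b)

/-- The free generator with upper indices `(i, j)` in the block `a` of the first list and lower
indices `(k, l)` in the block `b` of the second list. -/
def genX {D D' : BlockSizes} (a : Fin D.n) (i j : Fin (D.d a))
    (b : Fin D'.n) (k l : Fin (D'.d b)) : FreeAlgebra ℂ (GenLabel D D') :=
  FreeAlgebra.ι ℂ ⟨a, i, j, b, k, l⟩

/-- The defining relations (left side, right side) of the universal algebra of `(E, F)`. The
relations whose right side carries a Kronecker symbol comparing two blocks are split into the case
of equal blocks and the case of distinct blocks. -/
inductive UnivRel {D D' : BlockSizes} (E : Multimatrix D) (F : Multimatrix D') :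
    FreeAlgebra ℂ (GenLabel D D') → FreeAlgebra ℂ (GenLabel D D') → Prop
  | mul_same (c : Fin D.n) (r s : Fin (D.d c)) (b : Fin D'.n) (i j k l : Fin (D'.d b)) :
      UnivRel E F (∑ q, genX c r q b i j * genX c q s b k l)
        (if j = k then genX c r s b i l else 0)
  | mul_ne (c : Fin D.n) (r s : Fin (D.d c)) (b b' : Fin D'.n) (hb : b ≠ b')
      (i j : Fin (D'.d b)) (k l : Fin (D'.d b')) :
      UnivRel E F (∑ q, genX c r q b i j * genX c q s b' k l) 0
  | unit (a : Fin D.n) (i j : Fin (D.d a)) :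
      UnivRel E F (∑ b : Fin D'.n, ∑ k, genX a i j b k k) (if i = j then 1 else 0)
  | counit (b : Fin D'.n) (i j : Fin (D'.d b)) :
      UnivRel E F (∑ a : Fin D.n, ∑ k, ∑ l, (E⁻¹ a) k l • genX a k l b i j)
        (algebraMap ℂ _ ((F⁻¹ b) i j))
  | comul_same (a : Fin D.n) (i p q j : Fin (D.d a)) (b : Fin D'.n) (k l : Fin (D'.d b)) :
      UnivRel E F (∑ r, ∑ s, F b r s • (genX a i p b k r * genX a q j b s l))
        (E a p q • genX a i j b k l)
  | comul_ne (a c : Fin D.n) (hac : a ≠ c) (i p : Fin (D.d a)) (q j : Fin (D.d c))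
      (b : Fin D'.n) (k l : Fin (D'.d b)) :
      UnivRel E F (∑ r, ∑ s, F b r s • (genX a i p b k r * genX c q j b s l)) 0

/-- The universal (associative, unital) complex algebra on the generators and relations above. -/
abbrev UnivAlg {D D' : BlockSizes} (E : Multimatrix D) (F : Multimatrix D') : Type :=
  RingQuot (UnivRel E F)

end

/-! The algebra is shown to be nonzero by a linear functional on the free algebra that takes the
value 1 at the empty word and respects every relation in every context
(`nontrivial_ringQuot_of_wordFunctional`).

The upper indices of a word of generators form a closed path in a star-shaped quiver: a base vertex,
one further vertex for each block of `E`, and arrows in both directions. The lower indices do the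
same for `F`. Each relation then says that a cup inserted in one of the two paths has the same
effect as a cap applied at the same position to the other. The functional is therefore a sequence of
pairings between paths of equal even length for which the cups of each quiver are adjoint to the
caps of the other (`exists_adjoint_sequence`).

The pairings are built by induction on length. Extending in one variable is a diamond-lemma argument
(`CupQuiver.exists_extension`). The leading pair of a cup cannot overlap another leading pair, so
the only conditions on prescribed values at inserted cups come from two cups at disjoint positions,
and these hold by adjointness one level lower. Extending in both variables at once also requires
that inserting a cup on each side gives the same result in either order (`Adjoint.ins_contract`). At
equal positions this compares loop values, which are the traces assumed equal; at adjacent positions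
it is the zigzag identity; at distant positions it is the induction hypothesis.

Non-overlapping leading pairs need an off-diagonal zero entry in some block of `E⁻¹` and in some
block of `F`. Conjugation provides these entries in a block of size at least two, and it preserves
both the traces and the nontriviality of the algebra. -/

noncomputable section

/-! ### Quivers with cups and caps, and the leading pair of a cup. -/

/-- A finite quiver (vertices `V`, arrows `Ar`) with a base vertex and mutually inverse matrices of
cup and cap coefficients, supported on pairs of arrows that go back and forth between two vertices.
Each vertex `v` has a chosen outgoing arrow `top v`, and no two chosen arrows are linked by a cup. -/
structure CupQuiver (V Ar : Type) [Fintype Ar] [DecidableEq Ar] where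
  base : V
  src : Ar → V
  tgt : Ar → V
  cup : Matrix Ar Ar ℂ
  cap : Matrix Ar Ar ℂ
  cup_mul_cap : cup * cap = 1
  cap_mul_cup : cap * cup = 1
  cup_supp : ∀ x y, cup x y ≠ 0 → tgt x = src y ∧ src x = tgt y
  cap_supp : ∀ x y, cap x y ≠ 0 → tgt x = src y ∧ src x = tgt y
  top : V → Ar
  src_top : ∀ v, src (top v) = v
  cup_top : ∀ v w, cup (top v) (top w) = 0

namespace CupQuiver

variable {V Ar : Type} [Fintype Ar] [DecidableEq Ar] (Q : CupQuiver V Ar)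

/-- The vertex where a list of arrows starting at `v` ends. -/
def endFrom (v : V) (l : List Ar) : V := l.foldl (fun _ e => Q.tgt e) v

/-- The list is a path of composable arrows starting at `v`. -/
def IsPath : V → List Ar → Prop
  | _, [] => True
  | v, e :: l => Q.src e = v ∧ IsPath (Q.tgt e) l

@[simp] lemma endFrom_nil (v : V) : Q.endFrom v [] = v := rfl

@[simp] lemma endFrom_cons (v : V) (e : Ar) (l : List Ar) :
    Q.endFrom v (e :: l) = Q.endFrom (Q.tgt e) l := rfl

@[simp] lemma endFrom_append (v : V) (l l' : List Ar) :
    Q.endFrom v (l ++ l') = Q.endFrom (Q.endFrom v l) l' := by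
  simp [endFrom, List.foldl_append]

@[simp] lemma isPath_nil (v : V) : Q.IsPath v [] := trivial

@[simp] lemma isPath_cons (v : V) (e : Ar) (l : List Ar) :
    Q.IsPath v (e :: l) ↔ Q.src e = v ∧ Q.IsPath (Q.tgt e) l := Iff.rfl

@[simp] lemma isPath_append (v : V) (l l' : List Ar) :
    Q.IsPath v (l ++ l') ↔ Q.IsPath v l ∧ Q.IsPath (Q.endFrom v l) l' := by
  induction l generalizing v with
  | nil => simp
  | cons e l ih => simp [ih, and_assoc]

open Classical in
/-- The coefficient of a pair of arrows in the cup at the vertex `v`. -/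
def cupAt (v : V) (p : Ar × Ar) : ℂ := if Q.src p.1 = v then Q.cup p.1 p.2 else 0

lemma cupAt_ne_zero {v : V} {p : Ar × Ar} (h : Q.cupAt v p ≠ 0) :
    Q.src p.1 = v ∧ Q.tgt p.1 = Q.src p.2 ∧ Q.tgt p.2 = v ∧ Q.cup p.1 p.2 ≠ 0 := by
  unfold cupAt at h
  split_ifs at h with h1
  · obtain ⟨h2, h3⟩ := Q.cup_supp _ _ h
    exact ⟨h1, h2, h3 ▸ h1, h⟩
  · exact absurd rfl h

lemma exists_cup_top_ne_zero (v : V) : ∃ y, Q.cup (Q.top v) y ≠ 0 := by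
  by_contra! h
  have := congrFun (congrFun Q.cup_mul_cap (Q.top v)) (Q.top v)
  simp [Matrix.mul_apply, h] at this

/-- An arrow linked to `top v` by a cup. -/
def bot (v : V) : Ar := (Q.exists_cup_top_ne_zero v).choose

lemma cup_top_bot (v : V) : Q.cup (Q.top v) (Q.bot v) ≠ 0 := (Q.exists_cup_top_ne_zero v).choose_spec

lemma tgt_bot (v : V) : Q.tgt (Q.bot v) = v := by
  rw [← (Q.cup_supp _ _ (Q.cup_top_bot v)).2, Q.src_top]

lemma bot_ne_top (v w : V) : Q.bot v ≠ Q.top w := fun h =>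
  Q.cup_top_bot v (h ▸ Q.cup_top v w)

lemma cupAt_pivot (v : V) : Q.cupAt v (Q.top v, Q.bot v) = Q.cup (Q.top v) (Q.bot v) := by
  simp [cupAt, Q.src_top]

/-- The rank of an arrow, which makes the pair `(top v, bot v)` the largest pair in the cup at `v`. -/
def rk (e : Ar) : ℕ :=
  if e = Q.top (Q.src e) then 2 else if e = Q.bot (Q.tgt e) then 1 else 0

/-- The well-founded order on lists of arrows. -/
def lt : List Ar → List Ar → Prop := List.Shortlex (fun a b => Q.rk a < Q.rk b)

lemma lt_wf : WellFounded Q.lt := List.Shortlex.wf (InvImage.wf Q.rk Nat.lt_wfRel.wf)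

/-- Every term of a cup other than `(top v, bot v)` is strictly smaller, in any context. The cup
equation can thus be solved for its leading term by well-founded recursion. -/
lemma lt_pivot {v : V} {p : Ar × Ar} (hp : Q.cupAt v p ≠ 0) (hne : p ≠ (Q.top v, Q.bot v))
    (u w : List Ar) : Q.lt (u ++ p.1 :: p.2 :: w) (u ++ Q.top v :: Q.bot v :: w) := by
  obtain ⟨h1, h2, h3, h4⟩ := Q.cupAt_ne_zero hp
  refine List.Shortlex.of_lex (by simp) (List.Lex.append_left _ ?_ _)
  obtain ⟨x, y⟩ := p
  dsimp only at *
  by_cases hx : x = Q.top v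
  · subst hx
    have hy : y ≠ Q.bot v := fun h => hne (by rw [h])
    refine List.Lex.cons (List.Lex.rel ?_)
    -- `y` is no chosen arrow, because `cup_top` would make its coefficient with `top v` vanish.
    have e1 : Q.rk y = 0 := by
      unfold rk
      rw [if_neg (fun h : y = _ => h4 (by rw [h]; exact Q.cup_top _ _)), if_neg (by rwa [h3])]
    have e2 : Q.rk (Q.bot v) = 1 := by
      unfold rk
      rw [if_neg (Q.bot_ne_top _ _), if_pos (by rw [Q.tgt_bot])]
    omega
  · refine List.Lex.rel ?_
    have e1 : Q.rk (Q.top v) = 2 := by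
      unfold rk
      rw [if_pos (by rw [Q.src_top])]
    have e2 : Q.rk x < 2 := by
      unfold rk
      rw [if_neg (by rwa [h1])]
      split_ifs <;> omega
    omega

/-! ### Prescribing values on inserted cups: a diamond lemma. -/

/-- The value of a function of words on the cup inserted between `u` and `w`. -/
def ins (u w : List Ar) (f : List Ar → ℂ) : ℂ :=
  ∑ p : Ar × Ar, Q.cupAt (Q.endFrom Q.base u) p * f (u ++ p.1 :: p.2 :: w)

/-- The word contains a leading pair of a cup. -/
def HasPivot (w : List Ar) : Prop :=
  ∃ u w' : List Ar, w = u ++ Q.top (Q.endFrom Q.base u) :: Q.bot (Q.endFrom Q.base u) :: w'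

lemma sum_cupAt_eq_pivot (v : V) (φ : Ar × Ar → ℂ)
    (h : ∀ p, Q.cupAt v p ≠ 0 → p ≠ (Q.top v, Q.bot v) → φ p = 0) :
    ∑ p, Q.cupAt v p * φ p = Q.cup (Q.top v) (Q.bot v) * φ (Q.top v, Q.bot v) := by
  rw [Finset.sum_eq_single (Q.top v, Q.bot v), Q.cupAt_pivot]
  · intro p _ hp
    by_cases h0 : Q.cupAt v p = 0
    · rw [h0, zero_mul]
    · rw [h p h0 hp, mul_zero]
  · simp

/-- Two leading pairs could overlap only in one letter, which would be both a `bot` and a `top`;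
`bot_ne_top` forbids this. All ambiguities are therefore between disjoint pairs. -/
lemma pivot_overlap {u w u' w' : List Ar} {v v' : V}
    (h : u ++ Q.top v :: Q.bot v :: w = u' ++ Q.top v' :: Q.bot v' :: w')
    (hlt : u.length < u'.length) :
    ∃ B, u' = u ++ Q.top v :: Q.bot v :: B ∧ w = B ++ Q.top v' :: Q.bot v' :: w' := by
  rcases List.append_eq_append_iff.1 h with ⟨c, h1, h2⟩ | ⟨c, h1, h2⟩
  · subst h1
    match c, h2 with
    | [], _ => simp at hlt
    | [z], h2 =>
      simp only [List.cons_append, List.nil_append, List.cons.injEq] at h2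
      exact absurd h2.2.1 (Q.bot_ne_top _ _)
    | z₁ :: z₂ :: B, h2 =>
      simp only [List.cons_append, List.cons.injEq] at h2
      obtain ⟨rfl, rfl, rfl⟩ := h2
      exact ⟨B, rfl, rfl⟩
  · subst h1
    simp at hlt

lemma isPath_insert {u w : List Ar} {p : Ar × Ar} {v : V}
    (hp : Q.cupAt (Q.endFrom v u) p ≠ 0) :
    Q.IsPath v (u ++ p.1 :: p.2 :: w) ↔ Q.IsPath v (u ++ w) := by
  obtain ⟨h1, h2, h3, -⟩ := Q.cupAt_ne_zero hp
  simp [h1, h2, h3]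

lemma cupAt_pivot_ne_zero (v : V) : Q.cupAt v (Q.top v, Q.bot v) ≠ 0 := by
  rw [Q.cupAt_pivot]; exact Q.cup_top_bot v

open Classical in
/-- The solution of the insertion equations, by recursion on the order of words. -/
def extend (G : List Ar → List Ar → ℂ) (H : List Ar → ℂ) : List Ar → ℂ :=
  Q.lt_wf.fix fun l rec =>
    if h : Q.HasPivot l then
      let u := h.choose
      let w := h.choose_spec.choose
      let v := Q.endFrom Q.base u
      -- The cup equation solved for its leading term. The guard `hlt` licenses the recursive call;
      -- it discards only the leading term and terms with coefficient zero.
      (Q.cup (Q.top v) (Q.bot v))⁻¹ * (G u w - ∑ p : Ar × Ar,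
        if hlt : Q.lt (u ++ p.1 :: p.2 :: w) l then Q.cupAt v p * rec _ hlt else 0)
    else H l

lemma extend_of_not_hasPivot (G : List Ar → List Ar → ℂ) (H : List Ar → ℂ) {l : List Ar}
    (hl : ¬ Q.HasPivot l) : Q.extend G H l = H l := by
  unfold extend
  rw [WellFounded.fix_eq, dif_neg hl]

open Classical in
lemma extend_of_hasPivot (G : List Ar → List Ar → ℂ) (H : List Ar → ℂ) {l : List Ar}
    (hl : Q.HasPivot l) :
    ∃ u w, l = u ++ Q.top (Q.endFrom Q.base u) :: Q.bot (Q.endFrom Q.base u) :: w ∧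
      Q.ins u w (Q.extend G H) = G u w := by
  refine ⟨hl.choose, hl.choose_spec.choose, hl.choose_spec.choose_spec, ?_⟩
  have key := hl.choose_spec.choose_spec
  set u := hl.choose with hu
  set w := hl.choose_spec.choose with hw
  set v := Q.endFrom Q.base u with hv
  have hval : Q.extend G H l = (Q.cup (Q.top v) (Q.bot v))⁻¹ * (G u w - ∑ p : Ar × Ar,
        if hlt : Q.lt (u ++ p.1 :: p.2 :: w) l then
          Q.cupAt v p * Q.extend G H (u ++ p.1 :: p.2 :: w) else 0) := by
    unfold extend
    rw [WellFounded.fix_eq, dif_pos hl]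
  have hsplit : Q.ins u w (Q.extend G H) = (∑ p : Ar × Ar,
        if hlt : Q.lt (u ++ p.1 :: p.2 :: w) l then
          Q.cupAt v p * Q.extend G H (u ++ p.1 :: p.2 :: w) else 0) +
        Q.cup (Q.top v) (Q.bot v) * Q.extend G H l := by
    unfold ins
    rw [← sub_eq_iff_eq_add', ← Finset.sum_sub_distrib, Finset.sum_eq_single (Q.top v, Q.bot v)]
    · have : ¬ Q.lt (u ++ Q.top v :: Q.bot v :: w) l := by
        rw [← key]
        exact fun h => Q.lt_wf.asymmetric _ _ h h
      simp only [this, dite_false, sub_zero]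
      rw [Q.cupAt_pivot, ← key]
    · intro p _ hp
      by_cases h0 : Q.cupAt v p = 0
      · simp [← hv, h0]
      · have := Q.lt_pivot h0 hp u w
        rw [← key] at this
        simp [this, ← hv]
    · simp
  rw [hsplit, hval, mul_inv_cancel_left₀ (Q.cup_top_bot v)]
  ring

/-- Compatible prescribed values on inserted cups, and arbitrary values on words without pivot, are
realized by a function of words. -/
theorem exists_extension (m : ℕ) (G : List Ar → List Ar → ℂ) (H : List Ar → ℂ)
    (compat : ∀ A B C, Q.IsPath Q.base (A ++ (B ++ C)) → A.length + B.length + C.length + 2 = m →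
      ∑ p, Q.cupAt (Q.endFrom Q.base (A ++ B)) p * G A (B ++ p.1 :: p.2 :: C) =
      ∑ p, Q.cupAt (Q.endFrom Q.base A) p * G (A ++ p.1 :: p.2 :: B) C) :
    ∃ g : List Ar → ℂ,
      (∀ u w, Q.IsPath Q.base (u ++ w) → u.length + w.length = m → Q.ins u w g = G u w) ∧
      ∀ l, ¬ Q.HasPivot l → g l = H l := by
  refine ⟨Q.extend G H, ?_, fun l hl => Q.extend_of_not_hasPivot G H hl⟩
  set g := Q.extend G H with hg
  -- Each insertion equation is indexed by its leading word `l`, and the induction runs over these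
  -- words.
  suffices hmain : ∀ l u w, l = u ++ Q.top (Q.endFrom Q.base u) :: Q.bot (Q.endFrom Q.base u) :: w →
      Q.IsPath Q.base (u ++ w) → u.length + w.length = m → Q.ins u w g = G u w from
    fun u w => hmain _ u w rfl
  intro l
  induction l using Q.lt_wf.induction with
  | _ l ih =>
  -- Insert cups at both of two disjoint positions. By induction the errors of all non-leading terms
  -- vanish, so `compat` makes the errors of the two equations with leading word `l` proportional,
  -- with nonzero factors.
  have defect : ∀ A B C,
      l = A ++ Q.top (Q.endFrom Q.base A) :: Q.bot (Q.endFrom Q.base A) :: (B ++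
        Q.top (Q.endFrom Q.base (A ++ B)) :: Q.bot (Q.endFrom Q.base (A ++ B)) :: C) →
      Q.IsPath Q.base (A ++ (B ++ C)) → A.length + B.length + C.length + 2 = m →
      Q.cup (Q.top (Q.endFrom Q.base (A ++ B))) (Q.bot (Q.endFrom Q.base (A ++ B))) *
        (Q.ins A (B ++ Q.top (Q.endFrom Q.base (A ++ B)) :: Q.bot (Q.endFrom Q.base (A ++ B)) :: C)
          g - G A (B ++ Q.top (Q.endFrom Q.base (A ++ B)) ::
            Q.bot (Q.endFrom Q.base (A ++ B)) :: C)) =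
      Q.cup (Q.top (Q.endFrom Q.base A)) (Q.bot (Q.endFrom Q.base A)) *
        (Q.ins (A ++ Q.top (Q.endFrom Q.base A) :: Q.bot (Q.endFrom Q.base A) :: B) C g -
          G (A ++ Q.top (Q.endFrom Q.base A) :: Q.bot (Q.endFrom Q.base A) :: B) C) := by
    intro A B C hl hpath hlen
    have e1 := Q.sum_cupAt_eq_pivot (Q.endFrom Q.base (A ++ B))
      (fun p => Q.ins A (B ++ p.1 :: p.2 :: C) g - G A (B ++ p.1 :: p.2 :: C)) (by
        intro p hp hne
        rw [sub_eq_zero]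
        refine ih (A ++ Q.top (Q.endFrom Q.base A) :: Q.bot (Q.endFrom Q.base A) ::
          (B ++ p.1 :: p.2 :: C)) ?_ A _ rfl ?_ (by simp; omega)
        · have := Q.lt_pivot hp hne
            (A ++ Q.top (Q.endFrom Q.base A) :: Q.bot (Q.endFrom Q.base A) :: B) C
          rw [hl]
          simpa using this
        · rw [← List.append_assoc, Q.isPath_insert hp, List.append_assoc]
          exact hpath)
    have e2 := Q.sum_cupAt_eq_pivot (Q.endFrom Q.base A)
      (fun p => Q.ins (A ++ p.1 :: p.2 :: B) C g - G (A ++ p.1 :: p.2 :: B) C) (by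
        intro p hp hne
        rw [sub_eq_zero]
        have hend : Q.endFrom Q.base (A ++ p.1 :: p.2 :: B) = Q.endFrom Q.base (A ++ B) := by
          simp [(Q.cupAt_ne_zero hp).2.2.1]
        refine ih (A ++ p.1 :: p.2 :: B ++ Q.top (Q.endFrom Q.base (A ++ p.1 :: p.2 :: B)) ::
          Q.bot (Q.endFrom Q.base (A ++ p.1 :: p.2 :: B)) :: C) ?_ _ C rfl ?_ (by simp; omega)
        · have := Q.lt_pivot hp hne A (B ++ Q.top (Q.endFrom Q.base (A ++ B)) ::
            Q.bot (Q.endFrom Q.base (A ++ B)) :: C)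
          rw [hl, hend]
          simpa using this
        · have := (Q.isPath_insert (w := B ++ C) hp).2 hpath
          simpa using this)
    rw [← e1, ← e2]
    simp only [mul_sub, Finset.sum_sub_distrib]
    rw [compat A B C hpath hlen]
    congr 1
    simp only [ins, Finset.mul_sum]
    rw [Finset.sum_comm]
    refine Finset.sum_congr rfl fun p _ => Finset.sum_congr rfl fun q _ => ?_
    by_cases hp : Q.cupAt (Q.endFrom Q.base A) p = 0
    · simp [hp]
    · have hend : Q.endFrom Q.base (A ++ p.1 :: p.2 :: B) = Q.endFrom Q.base (A ++ B) := by
        simp [(Q.cupAt_ne_zero hp).2.2.1]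
      rw [hend]
      simp only [List.append_assoc, List.cons_append]
      ring
  intro u w hl hpath hlen
  -- By construction the equation holds for one chosen pivot of `l`; `defect` carries it to any
  -- other pivot.
  obtain ⟨u₀, w₀, hl₀, h₀⟩ := Q.extend_of_hasPivot G H ⟨u, w, hl⟩
  rw [← hg] at h₀
  have hpath₀ : Q.IsPath Q.base (u₀ ++ w₀) := by
    rw [← Q.isPath_insert (Q.cupAt_pivot_ne_zero _), ← hl₀, hl,
      Q.isPath_insert (Q.cupAt_pivot_ne_zero _)]
    exact hpath
  have endpiv : ∀ A B : List Ar, Q.endFrom Q.base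
      (A ++ Q.top (Q.endFrom Q.base A) :: Q.bot (Q.endFrom Q.base A) :: B) =
      Q.endFrom Q.base (A ++ B) := fun A B => by simp [Q.tgt_bot]
  rcases lt_trichotomy u.length u₀.length with h | h | h
  · obtain ⟨B, hu₀, hw⟩ := Q.pivot_overlap (hl.symm.trans hl₀) h
    subst hu₀
    rw [endpiv] at hw hl₀
    subst hw
    have hp' : Q.IsPath Q.base (u ++ (B ++ w₀)) := by
      rw [← Q.isPath_insert (Q.cupAt_pivot_ne_zero _)]
      simpa using hpath₀
    have := defect u B w₀ hl hp' (by simp at hlen; omega)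
    rw [h₀, sub_self, mul_zero] at this
    exact sub_eq_zero.1 ((mul_eq_zero.1 this).resolve_left (Q.cup_top_bot _))
  · obtain ⟨rfl, h2⟩ := List.append_inj (hl.symm.trans hl₀) h
    simp only [List.cons.injEq, true_and] at h2
    rw [h2, h₀]
  · obtain ⟨B, hu, hw₀⟩ := Q.pivot_overlap (hl₀.symm.trans hl) h
    subst hu
    rw [endpiv] at hw₀ hl
    subst hw₀
    have hp' : Q.IsPath Q.base (u₀ ++ (B ++ w)) := by
      rw [← Q.isPath_insert (Q.cupAt_pivot_ne_zero _)]
      simpa using hpath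
    have := defect u₀ B w hl₀ hp' (by simp at hlen; omega)
    rw [h₀, sub_self, mul_zero] at this
    exact sub_eq_zero.1 ((mul_eq_zero.1 this.symm).resolve_left (Q.cup_top_bot _))

/-- A function of words that vanishes on inserted cups and on words without pivot vanishes. -/
theorem eq_zero_of_ins_eq_zero (m : ℕ) (g : List Ar → ℂ)
    (hins : ∀ u w, Q.IsPath Q.base (u ++ w) → u.length + w.length = m → Q.ins u w g = 0)
    (hfree : ∀ l, Q.IsPath Q.base l → l.length = m + 2 → ¬ Q.HasPivot l → g l = 0) :
    ∀ l, Q.IsPath Q.base l → l.length = m + 2 → g l = 0 := by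
  intro l
  induction l using Q.lt_wf.induction with
  | _ l ih =>
  intro hpath hlen
  by_cases h : Q.HasPivot l
  · obtain ⟨u, w, rfl⟩ := h
    have hp' := (Q.isPath_insert (Q.cupAt_pivot_ne_zero _)).1 hpath
    have hlen' : u.length + w.length = m := by simp at hlen; omega
    have h1 := hins u w hp' hlen'
    unfold ins at h1
    rw [Q.sum_cupAt_eq_pivot _ (fun p => g (u ++ p.1 :: p.2 :: w))] at h1
    · exact (mul_eq_zero.1 h1).resolve_left (Q.cup_top_bot _)
    · intro p hp hne
      exact ih _ (Q.lt_pivot hp hne u w) ((Q.isPath_insert hp).2 hp') (by simp; omega)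
  · exact hfree l hpath hlen h

/-! ### Caps, loops and zigzag identities. -/

section basic
variable {V Ar : Type} [Fintype Ar] [DecidableEq Ar] (Q : CupQuiver V Ar)

/-- The value of a function of words on the cap applied to a word at the position `i`. -/
def contract (i : ℕ) (f : List Ar → ℂ) (l : List Ar) : ℂ :=
  match l.drop i with
  | a :: b :: r => Q.cap a b * f (l.take i ++ r)
  | _ => 0

lemma contract_append {i : ℕ} {p : List Ar} (hp : p.length = i) (a b : Ar) (q : List Ar)
    (f : List Ar → ℂ) : Q.contract i f (p ++ a :: b :: q) = Q.cap a b * f (p ++ q) := by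
  subst hp
  simp [contract]

lemma isPath_of_cap_ne_zero {v : V} {p q : List Ar} {a b : Ar} (h : Q.cap a b ≠ 0)
    (hp : Q.IsPath v (p ++ a :: b :: q)) :
    Q.IsPath v (p ++ q) ∧ Q.endFrom v (p ++ [a, b]) = Q.endFrom v p := by
  obtain ⟨h1, h2⟩ := Q.cap_supp _ _ h
  simp only [isPath_append, isPath_cons] at hp ⊢
  obtain ⟨hp1, hp2, hp3, hp4⟩ := hp
  rw [← h2, hp2] at hp4
  refine ⟨⟨hp1, hp4⟩, ?_⟩
  simp [← h2, hp2]

/-- The value of a closed loop at a vertex. -/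
def loop (v : V) : ℂ := ∑ p : Ar × Ar, Q.cupAt v p * Q.cap p.1 p.2

/-- Zigzag identity: this is `cup * cap = 1` read entrywise. The hypothesis on `e` ensures that
restricting the cup to the vertex `v` loses nothing. -/
lemma sum_cupAt_cap_right {v : V} {e : Ar} (he : Q.src e = v) (φ : Ar → ℂ) :
    ∑ p : Ar × Ar, Q.cupAt v p * (Q.cap p.2 e * φ p.1) = φ e := by
  classical
  have h1 : ∀ x, ∑ y, Q.cupAt v (x, y) * (Q.cap y e * φ x) = if x = e then φ e else 0 := by
    intro x
    have h2 := congrFun (congrFun Q.cup_mul_cap x) e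
    rw [Matrix.mul_apply] at h2
    simp only [← mul_assoc, ← Finset.sum_mul]
    by_cases hx : Q.src x = v
    · simp only [cupAt, hx, if_true, h2, Matrix.one_apply]
      split_ifs with h
      · rw [h, one_mul]
      · rw [zero_mul]
    · have : x ≠ e := fun h => hx (h ▸ he)
      simp [cupAt, hx, this]
  rw [Fintype.sum_prod_type]
  simp [h1]

lemma sum_cupAt_cap_left (a : Ar) (φ : Ar → ℂ) :
    ∑ p : Ar × Ar, Q.cupAt (Q.tgt a) p * (Q.cap a p.1 * φ p.2) = φ a := by
  classical
  have h1 : ∀ y, ∑ x, Q.cupAt (Q.tgt a) (x, y) * (Q.cap a x * φ y) =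
      if y = a then φ a else 0 := by
    intro y
    have h2 := congrFun (congrFun Q.cap_mul_cup a) y
    rw [Matrix.mul_apply] at h2
    have h3 : ∀ x, Q.cupAt (Q.tgt a) (x, y) * (Q.cap a x * φ y) =
        Q.cap a x * Q.cup x y * φ y := by
      intro x
      by_cases h0 : Q.cap a x = 0
      · simp [h0]
      · simp only [cupAt, (Q.cap_supp _ _ h0).1, if_true]
        ring
    simp only [h3, ← Finset.sum_mul, h2, Matrix.one_apply, eq_comm (a := a)]
    split_ifs with h
    · rw [h, one_mul]
    · rw [zero_mul]
  rw [Fintype.sum_prod_type_right]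
  simp [h1]

end basic

lemma exists_append_cons_cons {α : Type*} (l : List α) (i : ℕ) (h : i + 2 ≤ l.length) :
    ∃ p a b q, l = p ++ a :: b :: q ∧ p.length = i := by
  refine ⟨l.take i, l[i], l[i + 1], l.drop (i + 2), ?_, by simp; omega⟩
  rw [← List.drop_eq_getElem_cons, ← List.drop_eq_getElem_cons, List.take_append_drop]

/-! ### Adjoint pairings of paths in two quivers. -/

section pairing
variable {V₁ A₁ V₂ A₂ : Type} [Fintype A₁] [DecidableEq A₁] [Fintype A₂] [DecidableEq A₂]

/-- Cups of the first quiver are adjoint to caps of the second, for a pairing `Θ` of words of length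
`m` and a pairing `Θ'` of words of length `m + 2`. -/
def HalfAdjoint (Q₁ : CupQuiver V₁ A₁) (Q₂ : CupQuiver V₂ A₂) (m : ℕ)
    (Θ Θ' : List A₁ → List A₂ → ℂ) : Prop :=
  ∀ u w l, Q₁.IsPath Q₁.base (u ++ w) → u.length + w.length = m → Q₂.IsPath Q₂.base l →
    l.length = m + 2 → Q₁.ins u w (fun k => Θ' k l) = Q₂.contract u.length (Θ (u ++ w)) l

/-- Cups of each quiver are adjoint to caps of the other. -/
def Adjoint (Q₁ : CupQuiver V₁ A₁) (Q₂ : CupQuiver V₂ A₂) (m : ℕ)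
    (Θ Θ' : List A₁ → List A₂ → ℂ) : Prop :=
  HalfAdjoint Q₁ Q₂ m Θ Θ' ∧ HalfAdjoint Q₂ Q₁ m (flip Θ) (flip Θ')

variable (Q₁ : CupQuiver V₁ A₁) (Q₂ : CupQuiver V₂ A₂)

/-- The prescribed values are compatible because caps at two disjoint positions of `l` commute: by
adjointness one level lower, both sides equal the same double contraction paired by `Θ₀`. -/
lemma HalfAdjoint.exists_extension {m : ℕ} {Θ₀ Θ : List A₁ → List A₂ → ℂ}
    (h₀ : ∀ m₀, m₀ + 2 = m → HalfAdjoint Q₁ Q₂ m₀ Θ₀ Θ) {l : List A₂}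
    (hl : Q₂.IsPath Q₂.base l) (hlen : l.length = m + 2) (H : List A₁ → ℂ) :
    ∃ g : List A₁ → ℂ,
      (∀ u w, Q₁.IsPath Q₁.base (u ++ w) → u.length + w.length = m →
        Q₁.ins u w g = Q₂.contract u.length (Θ (u ++ w)) l) ∧
      ∀ k, ¬ Q₁.HasPivot k → g k = H k := by
  refine Q₁.exists_extension m (fun u w => Q₂.contract u.length (Θ (u ++ w)) l) H ?_
  intro A B C hpath hm
  have h₀ := h₀ _ hm
  obtain ⟨P, a, b, T, rfl, hP⟩ := exists_append_cons_cons l A.length (by omega)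
  obtain ⟨S, c, d, R, rfl, hS⟩ := exists_append_cons_cons T B.length (by simp at hlen; omega)
  have hlen' : P.length + S.length + R.length + 2 = m := by simp at hlen; omega
  have e1 : ∀ p : A₁ × A₁, Q₂.contract A.length (Θ (A ++ (B ++ p.1 :: p.2 :: C)))
      (P ++ a :: b :: (S ++ c :: d :: R)) =
      Q₂.cap a b * Θ (A ++ B ++ p.1 :: p.2 :: C) (P ++ S ++ c :: d :: R) := fun p => by
    rw [Q₂.contract_append hP]
    simp only [List.append_assoc]
  have e2 : ∀ p : A₁ × A₁, Q₂.contract (A ++ p.1 :: p.2 :: B).length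
      (Θ (A ++ p.1 :: p.2 :: B ++ C)) (P ++ a :: b :: (S ++ c :: d :: R)) =
      Q₂.cap c d * Θ (A ++ p.1 :: p.2 :: (B ++ C)) (P ++ a :: b :: (S ++ R)) := fun p => by
    have : P ++ a :: b :: (S ++ c :: d :: R) = (P ++ a :: b :: S) ++ c :: d :: R := by simp
    rw [this, Q₂.contract_append (by simp; omega)]
    simp only [List.append_assoc, List.cons_append]
  have l1 : ∑ p, Q₁.cupAt (Q₁.endFrom Q₁.base (A ++ B)) p * (Q₂.cap a b *
      Θ (A ++ B ++ p.1 :: p.2 :: C) (P ++ S ++ c :: d :: R)) =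
      Q₂.cap a b * Q₁.ins (A ++ B) C (fun k => Θ k (P ++ S ++ c :: d :: R)) := by
    rw [ins, Finset.mul_sum]
    exact Finset.sum_congr rfl fun p _ => by ring
  have l2 : ∑ p, Q₁.cupAt (Q₁.endFrom Q₁.base A) p * (Q₂.cap c d *
      Θ (A ++ p.1 :: p.2 :: (B ++ C)) (P ++ a :: b :: (S ++ R))) =
      Q₂.cap c d * Q₁.ins A (B ++ C) (fun k => Θ k (P ++ a :: b :: (S ++ R))) := by
    rw [ins, Finset.mul_sum]
    exact Finset.sum_congr rfl fun p _ => by ring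
  have r1 : Q₂.cap a b * Q₁.ins (A ++ B) C (fun k => Θ k (P ++ S ++ c :: d :: R)) =
      Q₂.cap a b * (Q₂.cap c d * Θ₀ (A ++ B ++ C) (P ++ S ++ R)) := by
    by_cases h0 : Q₂.cap a b = 0
    · simp [h0]
    have := (Q₂.isPath_of_cap_ne_zero h0 hl).1
    rw [h₀ (A ++ B) C _ (by simpa using hpath) (by simp) (by simpa using this)
      (by simp; omega), Q₂.contract_append (by simp; omega)]
  have r2 : Q₂.cap c d * Q₁.ins A (B ++ C) (fun k => Θ k (P ++ a :: b :: (S ++ R))) =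
      Q₂.cap c d * (Q₂.cap a b * Θ₀ (A ++ (B ++ C)) (P ++ (S ++ R))) := by
    by_cases h0 : Q₂.cap c d = 0
    · simp [h0]
    have := (Q₂.isPath_of_cap_ne_zero (p := P ++ a :: b :: S) h0 (by simpa using hl)).1
    rw [h₀ A (B ++ C) _ hpath (by simp; omega) (by simpa using this)
      (by simp; omega), Q₂.contract_append hP]
  simp only [e1, e2]
  rw [l1, l2, r1, r2]
  simp only [List.append_assoc]
  ring

/-- The distance between the two positions decides the reason. Distance zero gives a loop value on
each side; distance one gives a zigzag on each side; from distance two on, the cap avoids the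
inserted cup and adjointness one level lower applies. -/
lemma Adjoint.ins_contract_of_le {m : ℕ} {Θ₀ Θ : List A₁ → List A₂ → ℂ}
    (hloop : ∀ u u', Q₁.IsPath Q₁.base u → Q₂.IsPath Q₂.base u' → u.length = u'.length →
      Q₁.loop (Q₁.endFrom Q₁.base u) = Q₂.loop (Q₂.endFrom Q₂.base u'))
    (h₀ : ∀ m₀, m₀ + 2 = m → Adjoint Q₁ Q₂ m₀ Θ₀ Θ) {p q : List A₁} {u w : List A₂}
    (hp : Q₁.IsPath Q₁.base (p ++ q)) (hpm : p.length + q.length = m)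
    (hu : Q₂.IsPath Q₂.base (u ++ w)) (hum : u.length + w.length = m)
    (hle : u.length ≤ p.length) :
    Q₂.ins u w (Q₂.contract p.length (Θ (p ++ q))) =
      Q₁.ins p q (Q₁.contract u.length (flip Θ (u ++ w))) := by
  rcases hle.eq_or_lt with heq | hlt
  · have e1 : ∀ x : A₂ × A₂, Q₂.contract p.length (Θ (p ++ q)) (u ++ x.1 :: x.2 :: w) =
        Q₂.cap x.1 x.2 * Θ (p ++ q) (u ++ w) := fun x => Q₂.contract_append heq _ _ _ _
    have e2 : ∀ x : A₁ × A₁, Q₁.contract u.length (flip Θ (u ++ w)) (p ++ x.1 :: x.2 :: q) =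
        Q₁.cap x.1 x.2 * Θ (p ++ q) (u ++ w) := fun x => Q₁.contract_append heq.symm _ _ _ _
    have := hloop p u ((Q₁.isPath_append _ _ _).1 hp).1 ((Q₂.isPath_append _ _ _).1 hu).1 heq.symm
    simp only [ins, e1, e2, ← mul_assoc, ← Finset.sum_mul]
    unfold loop at this
    rw [this]
  rcases (Nat.succ_le_of_lt hlt).eq_or_lt with heq | hlt
  · obtain ⟨e, w, rfl⟩ : ∃ e w', w = e :: w' := by
      cases w with
      | nil => simp at hum; omega
      | cons e w' => exact ⟨e, w', rfl⟩
    obtain ⟨p, a, rfl⟩ : ∃ p' a, p = p' ++ [a] := by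
      rcases List.eq_nil_or_concat p with h | ⟨p', a, h⟩
      · simp [h] at heq
      · exact ⟨p', a, by simpa using h⟩
    have hpl : p.length = u.length := by simp at heq; omega
    have e1 : ∀ x : A₂ × A₂, Q₂.contract (p ++ [a]).length (Θ (p ++ [a] ++ q))
        (u ++ x.1 :: x.2 :: e :: w) =
        Q₂.cap x.2 e * Θ (p ++ [a] ++ q) (u ++ x.1 :: w) := fun x => by
      have : u ++ x.1 :: x.2 :: e :: w = (u ++ [x.1]) ++ x.2 :: e :: w := by simp
      rw [this, Q₂.contract_append (by simp; omega)]
      simp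
    have e2 : ∀ x : A₁ × A₁, Q₁.contract u.length (flip Θ (u ++ e :: w))
        (p ++ [a] ++ x.1 :: x.2 :: q) = Q₁.cap a x.1 * Θ (p ++ x.2 :: q) (u ++ e :: w) := fun x => by
      have : p ++ [a] ++ x.1 :: x.2 :: q = p ++ a :: x.1 :: (x.2 :: q) := by simp
      rw [this, Q₁.contract_append hpl]
      rfl
    simp only [ins, e1, e2]
    have hend : Q₁.endFrom Q₁.base (p ++ [a]) = Q₁.tgt a := by simp
    rw [Q₂.sum_cupAt_cap_right (e := e) (by simp at hu; exact hu.2.1)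
      (fun x => Θ (p ++ [a] ++ q) (u ++ x :: w)), hend,
      Q₁.sum_cupAt_cap_left a (fun y => Θ (p ++ y :: q) (u ++ e :: w))]
    simp
  -- The cap on each side falls on two letters `e`, `f` or `a`, `b` of the original words. Both
  -- sides become `cap e f * cap a b` times the same value of `Θ₀`.
  · obtain ⟨m, rfl⟩ : ∃ m₀, m = m₀ + 2 := ⟨m - 2, by omega⟩
    obtain ⟨h₁, h₂⟩ := h₀ m rfl
    obtain ⟨r, e, f, z, rfl, hr⟩ :=
      exists_append_cons_cons w (p.length - u.length - 2) (by omega)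
    obtain ⟨P, a, b, R, rfl, hP⟩ := exists_append_cons_cons p u.length (by omega)
    simp only [List.length_append, List.length_cons] at hr hpm hum
    have hRr : R.length = r.length := by omega
    have e1 : ∀ x : A₂ × A₂, Q₂.contract (P ++ a :: b :: R).length (Θ (P ++ a :: b :: R ++ q))
        (u ++ x.1 :: x.2 :: (r ++ e :: f :: z)) =
        Q₂.cap e f * Θ (P ++ a :: b :: (R ++ q)) (u ++ x.1 :: x.2 :: (r ++ z)) := fun x => by
      have : u ++ x.1 :: x.2 :: (r ++ e :: f :: z) = (u ++ x.1 :: x.2 :: r) ++ e :: f :: z := by simp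
      rw [this, Q₂.contract_append (by simp; omega)]
      simp
    have e2 : ∀ x : A₁ × A₁, Q₁.contract u.length (flip Θ (u ++ (r ++ e :: f :: z)))
        (P ++ a :: b :: R ++ x.1 :: x.2 :: q) =
        Q₁.cap a b * Θ (P ++ R ++ x.1 :: x.2 :: q) (u ++ r ++ e :: f :: z) := fun x => by
      have : P ++ a :: b :: R ++ x.1 :: x.2 :: q = P ++ a :: b :: (R ++ x.1 :: x.2 :: q) := by simp
      rw [this, Q₁.contract_append hP]
      simp [flip]
    have l1 : Q₂.ins u (r ++ e :: f :: z) (Q₂.contract (P ++ a :: b :: R).length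
        (Θ (P ++ a :: b :: R ++ q))) =
        Q₂.cap e f * Q₂.ins u (r ++ z) (fun k => flip Θ k (P ++ a :: b :: (R ++ q))) := by
      simp only [ins, e1, flip, Finset.mul_sum]
      exact Finset.sum_congr rfl fun x _ => by ring
    have r1 : Q₂.cap e f * Q₂.ins u (r ++ z) (fun k => flip Θ k (P ++ a :: b :: (R ++ q))) =
        Q₂.cap e f * (Q₁.cap a b * Θ₀ (P ++ (R ++ q)) (u ++ (r ++ z))) := by
      by_cases h0 : Q₂.cap e f = 0
      · simp [h0]
      have := (Q₂.isPath_of_cap_ne_zero (p := u ++ r) h0 (by simpa using hu)).1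
      rw [h₂ u (r ++ z) _ (by simpa using this) (by simp; omega) (by simpa using hp)
        (by simp; omega), Q₁.contract_append hP]
      rfl
    have r2 : Q₁.ins (P ++ a :: b :: R) q (Q₁.contract u.length (flip Θ (u ++ (r ++ e :: f :: z)))) =
        Q₁.cap a b * (Q₂.cap e f * Θ₀ (P ++ R ++ q) (u ++ r ++ z)) := by
      by_cases h0 : Q₁.cap a b = 0
      · simp only [ins, e2, h0]
        simp
      obtain ⟨h3, h4⟩ := Q₁.isPath_of_cap_ne_zero (p := P) (q := R ++ q) h0 (by simpa using hp)
      have h5 : Q₁.endFrom Q₁.base (P ++ a :: b :: R) = Q₁.endFrom Q₁.base (P ++ R) := by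
        have : P ++ a :: b :: R = (P ++ [a, b]) ++ R := by simp
        rw [this, Q₁.endFrom_append, h4, ← Q₁.endFrom_append]
      have := h₁ (P ++ R) q (u ++ r ++ e :: f :: z) (by simpa using h3) (by simp; omega)
        (by simpa using hu) (by simp; omega)
      rw [Q₂.contract_append (by simp; omega)] at this
      rw [← this]
      simp only [ins, e2, h5, Finset.mul_sum]
      exact Finset.sum_congr rfl fun x _ => by ring
    rw [l1, r1, r2]
    simp only [List.append_assoc]
    ring

lemma Adjoint.symm {m : ℕ} {Θ Θ' : List A₁ → List A₂ → ℂ} (h : Adjoint Q₁ Q₂ m Θ Θ') :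
    Adjoint Q₂ Q₁ m (flip Θ) (flip Θ') := ⟨h.2, h.1⟩

lemma Adjoint.ins_contract {m : ℕ} {Θ₀ Θ : List A₁ → List A₂ → ℂ}
    (hloop : ∀ u u', Q₁.IsPath Q₁.base u → Q₂.IsPath Q₂.base u' → u.length = u'.length →
      Q₁.loop (Q₁.endFrom Q₁.base u) = Q₂.loop (Q₂.endFrom Q₂.base u'))
    (h₀ : ∀ m₀, m₀ + 2 = m → Adjoint Q₁ Q₂ m₀ Θ₀ Θ) {p q : List A₁} {u w : List A₂}
    (hp : Q₁.IsPath Q₁.base (p ++ q)) (hpm : p.length + q.length = m)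
    (hu : Q₂.IsPath Q₂.base (u ++ w)) (hum : u.length + w.length = m) :
    Q₂.ins u w (Q₂.contract p.length (Θ (p ++ q))) =
      Q₁.ins p q (Q₁.contract u.length (flip Θ (u ++ w))) := by
  rcases le_total u.length p.length with h | h
  · exact Adjoint.ins_contract_of_le Q₁ Q₂ hloop h₀ hp hpm hu hum h
  · exact (Adjoint.ins_contract_of_le Q₂ Q₁ (Θ₀ := flip Θ₀) (Θ := flip Θ)
      (fun u u' hu hu' hl => (hloop u' u hu' hu hl.symm).symm)
      (fun m₀ hm => (h₀ m₀ hm).symm) hu hum hp hpm h).symm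

/-- An adjoint pair of pairings of words extends to words with two more letters. -/
theorem Adjoint.exists_next {m : ℕ} {Θ₀ Θ : List A₁ → List A₂ → ℂ}
    (hloop : ∀ u u', Q₁.IsPath Q₁.base u → Q₂.IsPath Q₂.base u' → u.length = u'.length →
      Q₁.loop (Q₁.endFrom Q₁.base u) = Q₂.loop (Q₂.endFrom Q₂.base u'))
    (h₀ : ∀ m₀, m₀ + 2 = m → Adjoint Q₁ Q₂ m₀ Θ₀ Θ) :
    ∃ Θ' : List A₁ → List A₂ → ℂ, Adjoint Q₁ Q₂ m Θ Θ' := by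
  classical
  -- For fixed `k`, `H k` satisfies the second adjointness alone, with value zero on words without
  -- pivot.
  have hH : ∀ k : List A₁, ∃ H : List A₂ → ℂ, Q₁.IsPath Q₁.base k → k.length = m + 2 →
      ∀ u w, Q₂.IsPath Q₂.base (u ++ w) → u.length + w.length = m →
        Q₂.ins u w H = Q₁.contract u.length (flip Θ (u ++ w)) k := by
    intro k
    by_cases hk : Q₁.IsPath Q₁.base k ∧ k.length = m + 2
    · obtain ⟨H, hH, -⟩ := HalfAdjoint.exists_extension Q₂ Q₁ (Θ₀ := flip Θ₀) (Θ := flip Θ)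
        (fun m₀ hm => (h₀ m₀ hm).2) hk.1 hk.2 0
      exact ⟨H, fun _ _ => hH⟩
    · exact ⟨0, fun h1 h2 => absurd ⟨h1, h2⟩ hk⟩
  choose H hH using hH
  -- For fixed `l`, `g l` satisfies the first adjointness, and its free values, those at words `k`
  -- without pivot, are taken from `H`.
  have hg : ∀ l : List A₂, ∃ g : List A₁ → ℂ, Q₂.IsPath Q₂.base l → l.length = m + 2 →
      (∀ u w, Q₁.IsPath Q₁.base (u ++ w) → u.length + w.length = m →
        Q₁.ins u w g = Q₂.contract u.length (Θ (u ++ w)) l) ∧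
      ∀ k, ¬ Q₁.HasPivot k → g k = H k l := by
    intro l
    by_cases hl : Q₂.IsPath Q₂.base l ∧ l.length = m + 2
    · obtain ⟨g, hg⟩ := HalfAdjoint.exists_extension Q₁ Q₂ (fun m₀ hm => (h₀ m₀ hm).1) hl.1 hl.2
        (fun k => H k l)
      exact ⟨g, fun _ _ => hg⟩
    · exact ⟨0, fun h1 h2 => absurd ⟨h1, h2⟩ hl⟩
  choose g hg using hg
  refine ⟨fun k l => g l k, fun u w l hu hm hl hlen => (hg l hl hlen).1 u w hu hm, ?_⟩
  intro u w k hu hum hk hkm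
  rw [← sub_eq_zero]
  -- The second adjointness is an identity between functions of `k`. It holds on inserted cups by
  -- `ins_contract`, and on words without pivot by the choice of free values.
  refine Q₁.eq_zero_of_ins_eq_zero m
    (fun k => Q₂.ins u w (fun l => g l k) - Q₁.contract u.length (flip Θ (u ++ w)) k) ?_ ?_ k hk hkm
  · intro p q hp hpm
    have e1 : Q₁.ins p q (fun k => Q₂.ins u w (fun l => g l k)) =
        Q₂.ins u w (Q₂.contract p.length (Θ (p ++ q))) := by
      simp only [ins, Finset.mul_sum]
      rw [Finset.sum_comm]
      refine Finset.sum_congr rfl fun x _ => ?_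
      by_cases hx : Q₂.cupAt (Q₂.endFrom Q₂.base u) x = 0
      · simp [hx]
      rw [← (hg (u ++ x.1 :: x.2 :: w) ((Q₂.isPath_insert hx).2 hu) (by simp; omega)).1 p q hp hpm,
        ins, Finset.mul_sum]
      exact Finset.sum_congr rfl fun y _ => by ring
    have e2 := Adjoint.ins_contract Q₁ Q₂ hloop h₀ hp hpm hu hum
    rw [← e1] at e2
    rw [← sub_eq_zero] at e2
    rw [← e2]
    simp only [ins, mul_sub, Finset.sum_sub_distrib]
  · intro k hk hkm hfree
    rw [sub_eq_zero, ← hH k hk hkm u w hu hum]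
    refine Finset.sum_congr rfl fun x _ => ?_
    by_cases hx : Q₂.cupAt (Q₂.endFrom Q₂.base u) x = 0
    · simp [hx]
    congr 1
    exact (hg _ ((Q₂.isPath_insert hx).2 hu) (by simp; omega)).2 k hfree

/-- There is a compatible sequence of pairings of words of even length, starting with `1`. -/
theorem exists_adjoint_sequence
    (hloop : ∀ u u', Q₁.IsPath Q₁.base u → Q₂.IsPath Q₂.base u' → u.length = u'.length →
      Q₁.loop (Q₁.endFrom Q₁.base u) = Q₂.loop (Q₂.endFrom Q₂.base u')) :
    ∃ T : ℕ → List A₁ → List A₂ → ℂ, T 0 [] [] = 1 ∧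
      ∀ k, Adjoint Q₁ Q₂ (2 * k) (T k) (T (k + 1)) := by
  -- At length zero there is no lower level, so `Θ₀` is arbitrary.
  obtain ⟨Θ₁, h₁⟩ := Adjoint.exists_next Q₁ Q₂ (m := 0) (Θ₀ := 0) (Θ := fun _ _ => 1) hloop
    (fun m₀ hm => by omega)
  let S : ∀ k : ℕ, {P : (List A₁ → List A₂ → ℂ) × (List A₁ → List A₂ → ℂ) //
      Adjoint Q₁ Q₂ (2 * k) P.1 P.2} := fun k => Nat.rec ⟨(fun _ _ => 1, Θ₁), h₁⟩
    (fun k P => ⟨(P.1.2, (Adjoint.exists_next Q₁ Q₂ (m := 2 * (k + 1)) (Θ₀ := P.1.1) (Θ := P.1.2)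
        hloop (fun m₀ hm => by
          obtain rfl : m₀ = 2 * k := by omega
          exact P.2)).choose),
      (Adjoint.exists_next Q₁ Q₂ (m := 2 * (k + 1)) (Θ₀ := P.1.1) (Θ := P.1.2) hloop
        (fun m₀ hm => by
          obtain rfl : m₀ = 2 * k := by omega
          exact P.2)).choose_spec⟩) k
  exact ⟨fun k => (S k).1.1, rfl, fun k => (S k).2⟩

end pairing
end CupQuiver

/-! ### Functionals on the free algebra and nontrivial quotients. -/

section functional
variable {X : Type}

lemma FreeAlgebra.basisFreeMonoid_apply (w : FreeMonoid X) :
    FreeAlgebra.basisFreeMonoid ℂ X w = FreeMonoid.lift (FreeAlgebra.ι ℂ) w := by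
  simp [FreeAlgebra.basisFreeMonoid, FreeAlgebra.equivMonoidAlgebraFreeMonoid]

/-- The linear functional on the free algebra with prescribed values on words, applied to the product
of an element with two words. -/
def wordFunctional (val : List X → ℂ) (u w : List X) : FreeAlgebra ℂ X →ₗ[ℂ] ℂ :=
  (FreeAlgebra.basisFreeMonoid ℂ X).constr ℂ (fun l => val (FreeMonoid.toList l)) ∘ₗ
    LinearMap.mulRight ℂ (FreeMonoid.lift (FreeAlgebra.ι ℂ) (FreeMonoid.ofList w)) ∘ₗ
    LinearMap.mulLeft ℂ (FreeMonoid.lift (FreeAlgebra.ι ℂ) (FreeMonoid.ofList u))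

lemma wordFunctional_lift (val : List X → ℂ) (u w : List X) (l : FreeMonoid X) :
    wordFunctional val u w (FreeMonoid.lift (FreeAlgebra.ι ℂ) l) =
      val (u ++ FreeMonoid.toList l ++ w) := by
  simp only [wordFunctional, LinearMap.comp_apply, LinearMap.mulRight_apply,
    LinearMap.mulLeft_apply, ← map_mul]
  rw [← FreeAlgebra.basisFreeMonoid_apply, Module.Basis.constr_basis]
  simp

lemma wordFunctional_one (val : List X → ℂ) (u w : List X) :
    wordFunctional val u w 1 = val (u ++ w) := by
  simpa using wordFunctional_lift val u w 1

lemma wordFunctional_algebraMap (val : List X → ℂ) (u w : List X) (c : ℂ) :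
    wordFunctional val u w (algebraMap ℂ _ c) = c * val (u ++ w) := by
  rw [Algebra.algebraMap_eq_smul_one, map_smul, wordFunctional_one, smul_eq_mul]

lemma wordFunctional_ι (val : List X → ℂ) (u w : List X) (x : X) :
    wordFunctional val u w (FreeAlgebra.ι ℂ x) = val (u ++ [x] ++ w) := by
  simpa using wordFunctional_lift val u w (FreeMonoid.of x)

lemma wordFunctional_ι_mul_ι (val : List X → ℂ) (u w : List X) (x y : X) :
    wordFunctional val u w (FreeAlgebra.ι ℂ x * FreeAlgebra.ι ℂ y) = val (u ++ [x, y] ++ w) := by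
  simpa using wordFunctional_lift val u w (FreeMonoid.of x * FreeMonoid.of y)

/-- A quotient of a free algebra is nontrivial if a nonzero functional on words respects the
relations in all contexts. -/
theorem nontrivial_ringQuot_of_wordFunctional {r : FreeAlgebra ℂ X → FreeAlgebra ℂ X → Prop}
    (val : List X → ℂ) (h1 : val [] ≠ 0)
    (hr : ∀ x y, r x y → ∀ u w, wordFunctional val u w x = wordFunctional val u w y) :
    Nontrivial (RingQuot r) := by
  have key : ∀ x y, r x y → ∀ a b, wordFunctional val [] [] (a * x * b) =
      wordFunctional val [] [] (a * y * b) := by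
    intro x y hxy a b
    have h := hr x y hxy
    -- Both sides are linear in `a` and in `b`, so it suffices to compare them on words, where the
    -- hypothesis applies.
    have e : (wordFunctional val [] []).comp (LinearMap.mulRight ℂ b) ∘ₗ LinearMap.mulRight ℂ x =
        (wordFunctional val [] []).comp (LinearMap.mulRight ℂ b) ∘ₗ LinearMap.mulRight ℂ y := by
      refine (FreeAlgebra.basisFreeMonoid ℂ X).ext fun u => ?_
      have e' : (wordFunctional val [] []).comp (LinearMap.mulLeft ℂ
            (FreeAlgebra.basisFreeMonoid ℂ X u * x)) =
          (wordFunctional val [] []).comp (LinearMap.mulLeft ℂ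
            (FreeAlgebra.basisFreeMonoid ℂ X u * y)) := by
        refine (FreeAlgebra.basisFreeMonoid ℂ X).ext fun w => ?_
        have := h (FreeMonoid.toList u) (FreeMonoid.toList w)
        simpa [wordFunctional, FreeAlgebra.basisFreeMonoid_apply, mul_assoc] using this
      simpa [mul_assoc] using LinearMap.congr_fun e' b
    simpa using LinearMap.congr_fun e a
  -- Elements are congruent when the functional cannot separate them in any context. The context `1,
  -- 1` separates 0 from 1.
  let c : RingCon (FreeAlgebra ℂ X) :=
    { r := fun x y => ∀ a b, wordFunctional val [] [] (a * x * b) =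
        wordFunctional val [] [] (a * y * b)
      iseqv := ⟨fun _ _ _ => rfl, fun h a b => (h a b).symm, fun h h' a b => (h a b).trans (h' a b)⟩
      add' := fun h h' a b => by
        simp only [mul_add, add_mul, map_add, h a b, h' a b]
      mul' := fun {w x y z} h h' a b => by
        have e1 := h a (y * b)
        have e2 := h' (a * x) b
        simp only [mul_assoc] at e1 e2 ⊢
        rw [e1, e2] }
  have hc : Nontrivial c.Quotient := by
    refine ⟨⟨((0 : FreeAlgebra ℂ X) : c.Quotient), ((1 : FreeAlgebra ℂ X) : c.Quotient), ?_⟩⟩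
    intro h
    have h2 : c 0 1 := (RingCon.eq c).1 h
    have h3 : wordFunctional val [] [] (1 * 0 * 1) = wordFunctional val [] [] (1 * 1 * 1) := h2 1 1
    rw [mul_zero, zero_mul, map_zero, mul_one, mul_one, wordFunctional_one] at h3
    exact h1 h3.symm
  exact (RingQuot.lift ⟨c.mk', fun x y hxy => (RingCon.eq c).2 (key x y hxy)⟩).domain_nontrivial

end functional

/-! ### The star-shaped quiver of a list of blocks. -/

section blocks

/-- The arrows of the quiver of a list of block sizes: each block `a` gives `D.d a` arrows from the
base vertex to the vertex `a` and as many arrows back. -/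
abbrev BlockSizes.Arrow (D : BlockSizes) : Type :=
  (Σ a : Fin D.n, Fin (D.d a)) ⊕ (Σ a : Fin D.n, Fin (D.d a))

variable (D : BlockSizes)

/-- The arrow from the base vertex with the given index. -/
abbrev BlockSizes.fwd (a : Fin D.n) (i : Fin (D.d a)) : D.Arrow := Sum.inl ⟨a, i⟩

/-- The arrow to the base vertex with the given index. -/
abbrev BlockSizes.bwd (a : Fin D.n) (i : Fin (D.d a)) : D.Arrow := Sum.inr ⟨a, i⟩

/-- The data of block matrices `g`, `h` from which the cups of a quiver are made, their inverses
`g'`, `h'`, and the indices of the leading arrows. -/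
structure CupBlocks where
  g : ∀ a, Matrix (Fin (D.d a)) (Fin (D.d a)) ℂ
  h : ∀ a, Matrix (Fin (D.d a)) (Fin (D.d a)) ℂ
  g' : ∀ a, Matrix (Fin (D.d a)) (Fin (D.d a)) ℂ
  h' : ∀ a, Matrix (Fin (D.d a)) (Fin (D.d a)) ℂ
  g_mul : ∀ a, g a * g' a = 1
  h_mul : ∀ a, h a * h' a = 1
  block : Fin D.n
  idx : Fin (D.d block)
  ret : ∀ a, Fin (D.d a)
  g_top : g block idx (ret block) = 0
  h_top : h block (ret block) idx = 0

variable {D}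
open Matrix

namespace CupBlocks

lemma blockDiagonal'_apply_ne_zero {g : ∀ a, Matrix (Fin (D.d a)) (Fin (D.d a)) ℂ}
    {x y : Σ a : Fin D.n, Fin (D.d a)} (h : blockDiagonal' g x y ≠ 0) : x.1 = y.1 := by
  by_contra hne
  exact h (blockDiagonal'_apply_ne g _ _ hne)

variable (B : CupBlocks D)

/-- The quiver of the block data. -/
def quiver : CupQuiver (Option (Fin D.n)) D.Arrow where
  base := none
  src := Sum.elim (fun _ => none) (fun x => some x.1)
  tgt := Sum.elim (fun x => some x.1) (fun _ => none)
  cup := fromBlocks 0 (blockDiagonal' B.g) (blockDiagonal' B.h) 0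
  cap := fromBlocks 0 (blockDiagonal' B.h') (blockDiagonal' B.g') 0
  cup_mul_cap := by
    simp only [fromBlocks_multiply, ← blockDiagonal'_mul, B.g_mul, B.h_mul]
    simp [← Pi.one_def]
  cap_mul_cup := by
    simp only [fromBlocks_multiply, ← blockDiagonal'_mul,
      fun a => mul_eq_one_comm.1 (B.g_mul a), fun a => mul_eq_one_comm.1 (B.h_mul a)]
    simp [← Pi.one_def]
  cup_supp := by
    rintro (x | x) (y | y) h
    · simp at h
    · simpa using blockDiagonal'_apply_ne_zero h
    · simpa using blockDiagonal'_apply_ne_zero h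
    · simp at h
  cap_supp := by
    rintro (x | x) (y | y) h
    · simp at h
    · simpa using blockDiagonal'_apply_ne_zero h
    · simpa using blockDiagonal'_apply_ne_zero h
    · simp at h
  top v := v.elim (D.fwd B.block B.idx) fun a => D.bwd a (B.ret a)
  src_top := by rintro (_ | a) <;> rfl
  cup_top := by
    rintro (_ | a) (_ | b)
    · rfl
    · by_cases h : B.block = b
      · subst h
        simpa using B.g_top
      · exact blockDiagonal'_apply_ne B.g _ _ h
    · by_cases h : a = B.block
      · subst h
        simpa using B.h_top
      · exact blockDiagonal'_apply_ne B.h _ _ h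
    · rfl

@[simp] lemma quiver_base : B.quiver.base = none := rfl
@[simp] lemma quiver_src_fwd (a i) : B.quiver.src (D.fwd a i) = none := rfl
@[simp] lemma quiver_src_bwd (a i) : B.quiver.src (D.bwd a i) = some a := rfl
@[simp] lemma quiver_tgt_fwd (a i) : B.quiver.tgt (D.fwd a i) = some a := rfl
@[simp] lemma quiver_tgt_bwd (a i) : B.quiver.tgt (D.bwd a i) = none := rfl

lemma quiver_cap_fwd_bwd (a i b j) :
    B.quiver.cap (D.fwd a i) (D.bwd b j) = blockDiagonal' B.h' ⟨a, i⟩ ⟨b, j⟩ := rfl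

lemma quiver_cap_bwd_fwd (a i b j) :
    B.quiver.cap (D.bwd a i) (D.fwd b j) = blockDiagonal' B.g' ⟨a, i⟩ ⟨b, j⟩ := rfl

lemma sum_cupAt_none (φ : D.Arrow × D.Arrow → ℂ) :
    ∑ p, B.quiver.cupAt none p * φ p =
      ∑ a, ∑ i, ∑ j, B.g a i j * φ (D.fwd a i, D.bwd a j) := by
  rw [Fintype.sum_prod_type, Fintype.sum_sum_type]
  have h0 : ∀ x : Σ a : Fin D.n, Fin (D.d a), ∑ y : D.Arrow,
      B.quiver.cupAt none (Sum.inr x, y) * φ (Sum.inr x, y) = 0 := fun x =>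
    Finset.sum_eq_zero fun y _ => by
      rw [CupQuiver.cupAt, if_neg (by simp [quiver]), zero_mul]
  simp only [h0, Finset.sum_const_zero, add_zero, Fintype.sum_sigma]
  refine Finset.sum_congr rfl fun a _ => Finset.sum_congr rfl fun i _ => ?_
  rw [Fintype.sum_sum_type]
  simp only [CupQuiver.cupAt, quiver, fromBlocks_apply₁₁, fromBlocks_apply₁₂, Matrix.zero_apply,
    Sum.elim_inl, if_true, zero_mul, Finset.sum_const_zero, zero_add, Fintype.sum_sigma]
  rw [Finset.sum_eq_single a]
  · simp
  · intro b _ hb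
    refine Finset.sum_eq_zero fun j _ => ?_
    rw [blockDiagonal'_apply_ne _ _ _ hb.symm, zero_mul]
  · simp

lemma sum_cupAt_some (c : Fin D.n) (φ : D.Arrow × D.Arrow → ℂ) :
    ∑ p, B.quiver.cupAt (some c) p * φ p =
      ∑ i, ∑ j, B.h c i j * φ (D.bwd c i, D.fwd c j) := by
  rw [Fintype.sum_prod_type, Fintype.sum_sum_type]
  have h0 : ∀ x : Σ a : Fin D.n, Fin (D.d a), ∑ y : D.Arrow,
      B.quiver.cupAt (some c) (Sum.inl x, y) * φ (Sum.inl x, y) = 0 := fun x =>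
    Finset.sum_eq_zero fun y _ => by
      rw [CupQuiver.cupAt, if_neg (by simp [quiver]), zero_mul]
  simp only [h0, Finset.sum_const_zero, zero_add, Fintype.sum_sigma]
  rw [Finset.sum_eq_single c]
  · refine Finset.sum_congr rfl fun i _ => ?_
    rw [Fintype.sum_sum_type]
    simp only [CupQuiver.cupAt, quiver, fromBlocks_apply₂₁, fromBlocks_apply₂₂, Matrix.zero_apply,
      Sum.elim_inr, if_true, zero_mul, Finset.sum_const_zero, add_zero, Fintype.sum_sigma]
    rw [Finset.sum_eq_single c]
    · simp
    · intro b _ hb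
      refine Finset.sum_eq_zero fun j _ => ?_
      rw [blockDiagonal'_apply_ne _ _ _ hb.symm, zero_mul]
    · simp
  · intro b _ hb
    refine Finset.sum_eq_zero fun j _ => Finset.sum_eq_zero fun y _ => ?_
    rw [CupQuiver.cupAt, if_neg (by simpa [quiver] using hb), zero_mul]
  · simp

lemma loop_none : B.quiver.loop none = ∑ a, ∑ i, ∑ j, B.g a i j * B.h' a i j := by
  rw [CupQuiver.loop, B.sum_cupAt_none (fun p => B.quiver.cap p.1 p.2)]
  simp [quiver_cap_fwd_bwd]

lemma loop_some (c : Fin D.n) : B.quiver.loop (some c) = ∑ i, ∑ j, B.h c i j * B.g' c i j := by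
  rw [CupQuiver.loop, B.sum_cupAt_some c (fun p => B.quiver.cap p.1 p.2)]
  simp [quiver_cap_bwd_fwd]

/-- The quiver is bipartite, with the base vertex on one side. Paths of equal length from the two
bases thus end both at a base or both at blocks, and those blocks may be any pair; hence the loop at
every block of one quiver is compared with the loop at every block of the other. -/
lemma isNone_endFrom {v : Option (Fin D.n)} {l : List D.Arrow} (hl : B.quiver.IsPath v l) :
    (B.quiver.endFrom v l).isNone = (v.isNone ^^ l.length.bodd) := by
  induction l generalizing v with
  | nil => simp
  | cons e l ih =>
    obtain ⟨h1, h2⟩ := hl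
    rw [CupQuiver.endFrom_cons, ih h2, ← h1]
    rcases e with ⟨a, i⟩ | ⟨a, i⟩ <;> simp [quiver]

lemma loop_eq_of_length_eq {D' : BlockSizes} (B' : CupBlocks D')
    (hnone : B.quiver.loop none = B'.quiver.loop none)
    (hsome : ∀ a b, B.quiver.loop (some a) = B'.quiver.loop (some b))
    (u : List D.Arrow) (u' : List D'.Arrow) (hu : B.quiver.IsPath B.quiver.base u)
    (hu' : B'.quiver.IsPath B'.quiver.base u') (hlen : u.length = u'.length) :
    B.quiver.loop (B.quiver.endFrom B.quiver.base u) =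
      B'.quiver.loop (B'.quiver.endFrom B'.quiver.base u') := by
  have h : (B.quiver.endFrom B.quiver.base u).isNone =
      (B'.quiver.endFrom B'.quiver.base u').isNone := by
    rw [B.isNone_endFrom hu, B'.isNone_endFrom hu', hlen, quiver_base, quiver_base]
    rfl
  generalize B.quiver.endFrom B.quiver.base u = v at h ⊢
  generalize B'.quiver.endFrom B'.quiver.base u' = v' at h ⊢
  match v, v' with
  | none, none => exact hnone
  | some a, some b => exact hsome a b
  | none, some b => simp at h
  | some a, none => simp at h

end CupBlocks
end blocks

open Matrix

/-! ### Adjointness in the form of the defining relations. -/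

namespace CupBlocks

/-- The list of arrows is a closed path at the base vertex. -/
def IsLoop {D : BlockSizes} (B : CupBlocks D) (l : List D.Arrow) : Prop :=
  B.quiver.IsPath none l ∧ B.quiver.endFrom none l = none

variable {D₁ D₂ : BlockSizes} (B₁ : CupBlocks D₁) (B₂ : CupBlocks D₂)

lemma sum_g_eq_of_halfAdjoint {k : ℕ} {Θ Θ' : List D₁.Arrow → List D₂.Arrow → ℂ}
    (hΘ : CupQuiver.HalfAdjoint B₁.quiver B₂.quiver (2 * k) Θ Θ') {U W : List D₁.Arrow}
    {U' W' : List D₂.Arrow} (hU : B₁.IsLoop U) (hW : B₁.IsLoop W) (hU' : B₂.IsLoop U')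
    (hW' : B₂.IsLoop W') (hUU' : U.length = U'.length) (hWW' : W.length = W'.length)
    (hk : U.length + W.length = 2 * k) (b : Fin D₂.n) (p q : Fin (D₂.d b)) :
    ∑ a, ∑ i, ∑ j, B₁.g a i j * Θ' (U ++ D₁.fwd a i :: D₁.bwd a j :: W)
      (U' ++ D₂.fwd b p :: D₂.bwd b q :: W') = B₂.h' b p q * Θ (U ++ W) (U' ++ W') := by
  have h := hΘ U W (U' ++ D₂.fwd b p :: D₂.bwd b q :: W') (by simp [hU.1, hU.2, hW.1]) hk
    (by simp [hU'.1, hU'.2, hW'.1]) (by simp; omega)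
  rw [B₂.quiver.contract_append hUU'.symm, quiver_cap_fwd_bwd, blockDiagonal'_apply_eq,
    CupQuiver.ins, quiver_base, hU.2, B₁.sum_cupAt_none (fun x => Θ' (U ++ x.1 :: x.2 :: W) _)] at h
  exact h

/-- The cup sits at the vertex `c`, after the outgoing arrow of a generator, and splits that
generator into two. The cap on the other side joins the return arrow of one generator to the
outgoing arrow of the next, so it vanishes for distinct blocks. -/
lemma sum_h_eq_of_halfAdjoint {k : ℕ} {Θ Θ' : List D₁.Arrow → List D₂.Arrow → ℂ}
    (hΘ : CupQuiver.HalfAdjoint B₁.quiver B₂.quiver (2 * k) Θ Θ') {U W : List D₁.Arrow}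
    {U' W' : List D₂.Arrow} (hU : B₁.IsLoop U) (hW : B₁.IsLoop W) (hU' : B₂.IsLoop U')
    (hW' : B₂.IsLoop W') (hUU' : U.length = U'.length) (hWW' : W.length = W'.length)
    (hk : U.length + W.length + 2 = 2 * k) (c : Fin D₁.n) (i j : Fin (D₁.d c)) (b : Fin D₂.n)
    (p q : Fin (D₂.d b)) (b' : Fin D₂.n) (p' q' : Fin (D₂.d b')) :
    ∑ x, ∑ y, B₁.h c x y *
      Θ' (U ++ D₁.fwd c i :: D₁.bwd c x :: D₁.fwd c y :: D₁.bwd c j :: W)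
      (U' ++ D₂.fwd b p :: D₂.bwd b q :: D₂.fwd b' p' :: D₂.bwd b' q' :: W') =
    blockDiagonal' B₂.g' ⟨b, q⟩ ⟨b', p'⟩ * Θ (U ++ D₁.fwd c i :: D₁.bwd c j :: W)
      (U' ++ D₂.fwd b p :: D₂.bwd b' q' :: W') := by
  have h := hΘ (U ++ [D₁.fwd c i]) (D₁.bwd c j :: W)
    ((U' ++ [D₂.fwd b p]) ++ D₂.bwd b q :: D₂.fwd b' p' :: (D₂.bwd b' q' :: W'))
    (by simp [hU.1, hU.2, hW.1]) (by simp; omega)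
    (by simp [hU'.1, hU'.2, hW'.1]) (by simp; omega)
  have hend : B₁.quiver.endFrom none (U ++ [D₁.fwd c i]) = some c := by simp
  rw [B₂.quiver.contract_append (by simp; omega), quiver_cap_bwd_fwd,
    CupQuiver.ins, quiver_base, hend,
    B₁.sum_cupAt_some c (fun x => Θ' (U ++ [D₁.fwd c i] ++ x.1 :: x.2 :: (D₁.bwd c j :: W)) _)] at h
  simpa only [List.append_assoc, List.cons_append, List.nil_append] using h

end CupBlocks

/-! ### Words of generators as pairs of closed paths. -/

section words
variable {D D' : BlockSizes}

/-- The upper indices of a word of generators as a list of arrows. -/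
def upperWord (l : List (GenLabel D D')) : List D.Arrow :=
  l.flatMap fun x => [D.fwd x.a x.i, D.bwd x.a x.j]

/-- The lower indices of a word of generators as a list of arrows. -/
def lowerWord (l : List (GenLabel D D')) : List D'.Arrow :=
  l.flatMap fun x => [D'.fwd x.b x.k, D'.bwd x.b x.l]

lemma length_upperWord (l : List (GenLabel D D')) : (upperWord l).length = 2 * l.length := by
  induction l with
  | nil => rfl
  | cons x l ih => simp [upperWord] at ih ⊢; omega

lemma length_lowerWord (l : List (GenLabel D D')) : (lowerWord l).length = 2 * l.length := by
  induction l with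
  | nil => rfl
  | cons x l ih => simp [lowerWord] at ih ⊢; omega

lemma isLoop_upperWord (B : CupBlocks D) (l : List (GenLabel D D')) : B.IsLoop (upperWord l) := by
  induction l with
  | nil => exact ⟨trivial, rfl⟩
  | cons x l ih => exact ⟨⟨rfl, rfl, ih.1⟩, ih.2⟩

lemma isLoop_lowerWord (B : CupBlocks D') (l : List (GenLabel D D')) : B.IsLoop (lowerWord l) := by
  induction l with
  | nil => exact ⟨trivial, rfl⟩
  | cons x l ih => exact ⟨⟨rfl, rfl, ih.1⟩, ih.2⟩

/-- The value on a word of generators of a sequence of pairings of lists of arrows. -/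
def wordValue (T : ℕ → List D'.Arrow → List D.Arrow → ℂ) (l : List (GenLabel D D')) : ℂ :=
  T l.length (lowerWord l) (upperWord l)

variable (T : ℕ → List D'.Arrow → List D.Arrow → ℂ) (u w : List (GenLabel D D'))

lemma wordValue_append : wordValue T (u ++ w) =
    T (u.length + w.length) (lowerWord u ++ lowerWord w) (upperWord u ++ upperWord w) := by
  simp [wordValue, lowerWord, upperWord]

lemma wordFunctional_genX (a i j b k l) :
    wordFunctional (wordValue T) u w (genX a i j b k l) =
      T (u.length + w.length + 1) (lowerWord u ++ D'.fwd b k :: D'.bwd b l :: lowerWord w)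
        (upperWord u ++ D.fwd a i :: D.bwd a j :: upperWord w) := by
  have : (u ++ ([⟨a, i, j, b, k, l⟩] : List (GenLabel D D')) ++ w).length = u.length + w.length + 1 := by simp; omega
  rw [genX, wordFunctional_ι, wordValue, this]
  simp [lowerWord, upperWord]

lemma wordFunctional_genX_mul (a i j b k l a' i' j' b' k' l') :
    wordFunctional (wordValue T) u w (genX a i j b k l * genX a' i' j' b' k' l') =
      T (u.length + w.length + 1 + 1)
        (lowerWord u ++ D'.fwd b k :: D'.bwd b l :: D'.fwd b' k' :: D'.bwd b' l' :: lowerWord w)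
        (upperWord u ++ D.fwd a i :: D.bwd a j :: D.fwd a' i' :: D.bwd a' j' :: upperWord w) := by
  have : (u ++ ([⟨a, i, j, b, k, l⟩, ⟨a', i', j', b', k', l'⟩] : List (GenLabel D D')) ++ w).length =
    u.length + w.length + 1 + 1 := by simp; omega
  rw [genX, genX, wordFunctional_ι_mul_ι, wordValue, this]
  simp [lowerWord, upperWord]

end words

/-! ### Nontriviality in the presence of off-diagonal zeros. -/

variable {D D' : BlockSizes} (E : Multimatrix D) (F : Multimatrix D')

/-- The cup data of the lower indices. -/
def lowerBlocks (N : Fin D'.n) (i j : Fin (D'.d N)) (hij : i ≠ j)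
    (h : (F N : Matrix (Fin (D'.d N)) (Fin (D'.d N)) ℂ) j i = 0) : CupBlocks D' where
  g _ := 1
  h a := (F a).val
  g' _ := 1
  h' a := (F⁻¹ a).val
  g_mul _ := by simp
  h_mul a := by rw [Pi.inv_apply, ← Units.val_mul, mul_inv_cancel, Units.val_one]
  block := N
  idx := i
  -- Only the return index in the block `N` matters: between distinct blocks the cup vanishes
  -- anyway, so the value 0 elsewhere is arbitrary.
  ret := Function.update (fun a => ⟨0, D'.d_pos a⟩) N j
  g_top := by simp [hij]
  h_top := by simpa using h

/-- The cup data of the upper indices. -/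
def upperBlocks (N : Fin D.n) (i j : Fin (D.d N)) (hij : i ≠ j)
    (h : (E⁻¹ N : Matrix (Fin (D.d N)) (Fin (D.d N)) ℂ) i j = 0) : CupBlocks D where
  g a := (E⁻¹ a).val
  h _ := 1
  g' a := (E a).val
  h' _ := 1
  g_mul a := by rw [Pi.inv_apply, ← Units.val_mul, inv_mul_cancel, Units.val_one]
  h_mul _ := by simp
  block := N
  idx := i
  ret := Function.update (fun a => ⟨0, D.d_pos a⟩) N j
  g_top := by simpa using h
  h_top := by simp [hij.symm]

/-- The algebra is nontrivial if both multimatrices have suitable off-diagonal zero entries. -/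
theorem nontrivial_univAlg_of_apply_eq_zero
    (hTr : Multimatrix.Tr E⁻¹ = Multimatrix.Tr F⁻¹)
    (htr : ∀ (a : Fin D.n) (b : Fin D'.n),
      (E a : Matrix (Fin (D.d a)) (Fin (D.d a)) ℂ).trace =
        (F b : Matrix (Fin (D'.d b)) (Fin (D'.d b)) ℂ).trace)
    (N : Fin D.n) (i j : Fin (D.d N)) (hij : i ≠ j)
    (hE : (E⁻¹ N : Matrix (Fin (D.d N)) (Fin (D.d N)) ℂ) i j = 0)
    (N' : Fin D'.n) (i' j' : Fin (D'.d N')) (hij' : i' ≠ j')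
    (hF : (F N' : Matrix (Fin (D'.d N')) (Fin (D'.d N')) ℂ) j' i' = 0) :
    Nontrivial (UnivAlg E F) := by
  let B₁ := lowerBlocks F N' i' j' hij' hF
  let B₂ := upperBlocks E N i j hij hE
  obtain ⟨T, hT0, hT⟩ := CupQuiver.exists_adjoint_sequence B₁.quiver B₂.quiver
    -- The loops at the bases are `Tr(F⁻¹)` and `Tr(E⁻¹)`; those at the blocks are the traces of the
    -- blocks of `F` and `E`.
    (B₁.loop_eq_of_length_eq B₂
      (by
        rw [CupBlocks.loop_none, CupBlocks.loop_none]
        simpa [B₁, B₂, lowerBlocks, upperBlocks, one_apply, Multimatrix.Tr, Matrix.trace] using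
          hTr.symm)
      (fun b a => by
        rw [CupBlocks.loop_some, CupBlocks.loop_some]
        simpa [B₁, B₂, lowerBlocks, upperBlocks, one_apply, Multimatrix.Tr, Matrix.trace] using
          (htr a b).symm))
  refine nontrivial_ringQuot_of_wordFunctional (wordValue T) ?_ ?_
  · change T 0 [] [] ≠ 0
    rw [hT0]
    exact one_ne_zero
  intro x y hxy u w
  have hu := isLoop_upperWord B₂ u
  have hw := isLoop_upperWord B₂ w
  have hu' := isLoop_lowerWord B₁ u
  have hw' := isLoop_lowerWord B₁ w
  have lu : (upperWord u).length = (lowerWord u).length := by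
    rw [length_upperWord, length_lowerWord]
  have lw : (upperWord w).length = (lowerWord w).length := by
    rw [length_upperWord, length_lowerWord]
  have lk : (upperWord u).length + (upperWord w).length = 2 * (u.length + w.length) := by
    rw [length_upperWord, length_upperWord]; ring
  -- Upper cups give `mul` (at a block, cap the identity) and `counit` (at the base, cap `F⁻¹`).
  -- Lower cups give `unit` (at the base, cap the identity) and `comul` (at a block, cap `E`).
  induction hxy with
  | mul_same c r s b i j k l =>
    have h := B₂.sum_h_eq_of_halfAdjoint B₁ (hT (u.length + w.length + 1)).2 hu hw hu' hw' lu lw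
      (by omega) c r s b i j b k l
    rw [map_sum]
    simp only [wordFunctional_genX_mul]
    simp only [B₁, B₂, lowerBlocks, upperBlocks, flip, one_apply, ite_mul, one_mul, zero_mul,
      Finset.sum_ite_eq, Finset.mem_univ, if_true, blockDiagonal'_apply_eq] at h
    rw [h]
    split_ifs with hjk
    · rw [wordFunctional_genX]
    · rw [map_zero]
  | mul_ne c r s b b' hb i j k l =>
    have h := B₂.sum_h_eq_of_halfAdjoint B₁ (hT (u.length + w.length + 1)).2 hu hw hu' hw' lu lw
      (by omega) c r s b i j b' k l
    rw [map_sum, map_zero]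
    simp only [wordFunctional_genX_mul]
    rw [blockDiagonal'_apply_ne _ _ _ hb, zero_mul] at h
    simpa only [B₁, B₂, lowerBlocks, upperBlocks, flip, one_apply, ite_mul, one_mul, zero_mul,
      Finset.sum_ite_eq, Finset.mem_univ, if_true] using h
  | unit a i j =>
    have h := B₁.sum_g_eq_of_halfAdjoint B₂ (hT (u.length + w.length)).1 hu' hw' hu hw lu.symm
      lw.symm (by omega) a i j
    simp only [map_sum, wordFunctional_genX]
    simp only [B₁, B₂, lowerBlocks, upperBlocks, one_apply, ite_mul, one_mul, zero_mul,
      Finset.sum_ite_eq, Finset.mem_univ, if_true] at h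
    rw [h]
    split_ifs with hij
    · rw [wordFunctional_one, wordValue_append]
    · rw [map_zero]
  | counit b i j =>
    have h := B₂.sum_g_eq_of_halfAdjoint B₁ (hT (u.length + w.length)).2 hu hw hu' hw' lu lw
      (by omega) b i j
    simp only [map_sum, map_smul, wordFunctional_genX, smul_eq_mul, wordFunctional_algebraMap,
      wordValue_append]
    exact h
  | comul_same a i p q j b k l =>
    have h := B₁.sum_h_eq_of_halfAdjoint B₂ (hT (u.length + w.length + 1)).1 hu' hw' hu hw lu.symm
      lw.symm (by omega) b k l a i p a q j
    simp only [map_sum, map_smul, wordFunctional_genX, wordFunctional_genX_mul, smul_eq_mul]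
    rw [blockDiagonal'_apply_eq] at h
    exact h
  | comul_ne a c hac i p q j b k l =>
    have h := B₁.sum_h_eq_of_halfAdjoint B₂ (hT (u.length + w.length + 1)).1 hu' hw' hu hw lu.symm
      lw.symm (by omega) b k l a i p c q j
    simp only [map_sum, map_smul, wordFunctional_genX_mul, smul_eq_mul, map_zero]
    rw [blockDiagonal'_apply_ne _ _ _ hac, zero_mul] at h
    exact h

/-! ### Invariance under conjugation of the multimatrices. -/

section conj
variable {m m' R : Type} [Fintype m] [Fintype m'] [Ring R] [Algebra ℂ R]

/-- The entries of the product of a family with complex matrices on the left and on the right. -/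
def conjEntries (A B : Matrix m m ℂ) (x : m → m → R) (i j : m) : R :=
  ∑ z : m × m, (A i z.1 * B z.2 j) • x z.1 z.2

lemma conjEntries_sum {ι : Type} [Fintype ι] (A B : Matrix m m ℂ) (x : ι → m → m → R) (i j : m) :
    conjEntries A B (fun k l => ∑ t, x t k l) i j = ∑ t, conjEntries A B (x t) i j := by
  simp only [conjEntries, Finset.smul_sum]
  exact Finset.sum_comm

lemma conjEntries_smul (A B : Matrix m m ℂ) (c : ℂ) (x : m → m → R) (i j : m) :
    conjEntries A B (fun k l => c • x k l) i j = c • conjEntries A B x i j := by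
  simp only [conjEntries, Finset.smul_sum, smul_comm c]

lemma conjEntries_zero (A B : Matrix m m ℂ) (i j : m) :
    conjEntries A B (fun _ _ => (0 : R)) i j = 0 := by
  simp [conjEntries]

lemma conjEntries_eq_mul (A B : Matrix m m ℂ) (x : m → m → R) (i j : m) :
    conjEntries A B x i j =
      (A.map (algebraMap ℂ R) * of x * B.map (algebraMap ℂ R)) i j := by
  rw [conjEntries, Fintype.sum_prod_type_right, mul_apply]
  refine Finset.sum_congr rfl fun j' _ => ?_
  rw [mul_apply, Finset.sum_mul]
  refine Finset.sum_congr rfl fun i' _ => ?_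
  rw [map_apply, map_apply, of_apply, ← Algebra.commutes, ← mul_assoc, ← map_mul, mul_comm (B j' j),
    Algebra.smul_def]

lemma sum_smul_mul_eq_mul (F : Matrix m m ℂ) (x y : m → m → R) (k l : m) :
    ∑ r, ∑ s, F r s • (x k r * y s l) = (of x * F.map (algebraMap ℂ R) * of y) k l := by
  rw [Finset.sum_comm, mul_apply]
  refine Finset.sum_congr rfl fun s _ => ?_
  rw [mul_apply, Finset.sum_mul]
  refine Finset.sum_congr rfl fun r _ => ?_
  rw [map_apply, of_apply, of_apply, ← Algebra.commutes, Algebra.smul_def, mul_assoc]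

/-- The left side is an entry of `(A x B) F (A y B)`, which regroups as `A (x (B F A) y) B`. -/
lemma sum_smul_conjEntries_mul (A B F : Matrix m m ℂ) (x y : m → m → R) (k l : m) :
    ∑ r, ∑ s, F r s • (conjEntries A B x k r * conjEntries A B y s l) =
      conjEntries A B (fun k' l' => ∑ r, ∑ s, (B * F * A) r s • (x k' r * y s l')) k l := by
  have hx : ∀ z : m → m → R, of (conjEntries A B z) =
      A.map (algebraMap ℂ R) * of z * B.map (algebraMap ℂ R) := fun z =>
    Matrix.ext fun i j => conjEntries_eq_mul A B z i j
  have hy : of (fun k' l' => ∑ r, ∑ s, (B * F * A) r s • (x k' r * y s l')) =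
      of x * (B * F * A).map (algebraMap ℂ R) * of y :=
    Matrix.ext fun i j => sum_smul_mul_eq_mul _ x y i j
  rw [sum_smul_mul_eq_mul, conjEntries_eq_mul, hx, hx, hy]
  simp only [Matrix.map_mul, Matrix.mul_assoc]

lemma sum_conjEntries_mul [DecidableEq m] {A B : Matrix m m ℂ} (hBA : B * A = 1) (x y : m → m → R) (k l : m) :
    ∑ r, conjEntries A B x k r * conjEntries A B y r l =
      conjEntries A B (fun k' l' => ∑ r, x k' r * y r l') k l := by
  have := sum_smul_conjEntries_mul A B 1 x y k l
  simpa [hBA, one_apply, ite_smul] using this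

lemma conjEntries_algebraMap (A B c : Matrix m m ℂ) (i j : m) :
    conjEntries A B (fun k l => algebraMap ℂ R (c k l)) i j = algebraMap ℂ R ((A * c * B) i j) := by
  rw [conjEntries_eq_mul]
  have : of (fun k l => algebraMap ℂ R (c k l)) = c.map (algebraMap ℂ R) := rfl
  rw [this, ← Matrix.map_mul, ← Matrix.map_mul, map_apply]

lemma conjEntries_ite [DecidableEq m] {A B : Matrix m m ℂ} (hAB : A * B = 1) (i j : m) :
    conjEntries A B (fun k l => if k = l then (1 : R) else 0) i j = if i = j then 1 else 0 := by
  have := conjEntries_algebraMap (R := R) A B 1 i j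
  simpa [hAB, one_apply, apply_ite (algebraMap ℂ R)] using this

lemma sum_smul_conjEntries (A B e : Matrix m m ℂ) (x : m → m → R) :
    ∑ k, ∑ l, e k l • conjEntries A B x k l = ∑ k, ∑ l, (Aᵀ * e * Bᵀ) k l • x k l := by
  rw [← Fintype.sum_prod_type' (f := fun k l => e k l • conjEntries A B x k l),
    ← Fintype.sum_prod_type' (f := fun k l => (Aᵀ * e * Bᵀ) k l • x k l)]
  simp only [conjEntries, Finset.smul_sum]
  rw [Finset.sum_comm]
  refine Finset.sum_congr rfl fun z _ => ?_
  rw [mul_apply, Finset.sum_smul, Fintype.sum_prod_type_right]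
  refine Finset.sum_congr rfl fun l _ => ?_
  rw [mul_apply, Finset.sum_mul, Finset.sum_smul]
  refine Finset.sum_congr rfl fun k _ => ?_
  rw [smul_smul]
  congr 1
  simp only [transpose_apply]
  ring

lemma sum_smul_conjEntries_mul_conjEntries {ι : Type} [Fintype ι] (c : ι → ℂ)
    (A B : Matrix m m ℂ) (A' B' : Matrix m' m' ℂ) (x : ι → m → m → R) (y : ι → m' → m' → R)
    (i p : m) (q j : m') :
    ∑ t, c t • (conjEntries A B (x t) i p * conjEntries A' B' (y t) q j) =
      ∑ z : m × m, ∑ z' : m' × m', (A i z.1 * B z.2 p * (A' q z'.1 * B' z'.2 j)) •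
        ∑ t, c t • (x t z.1 z.2 * y t z'.1 z'.2) := by
  simp only [conjEntries, Finset.sum_mul_sum, Finset.smul_sum]
  rw [Finset.sum_comm]
  refine Finset.sum_congr rfl fun z _ => ?_
  rw [Finset.sum_comm]
  refine Finset.sum_congr rfl fun z' _ => Finset.sum_congr rfl fun t _ => ?_
  rw [smul_mul_smul_comm, smul_comm]

/-- The inner indices `p` and `q` are transformed by `B` on the right and by `A` on the left, so the
coefficient matrix `e` becomes `Bᵀ * e * Aᵀ`, while the outer indices are those of a conjugate of
`w`. -/
lemma sum_smul_conjEntries_mul_conjEntries_of_eq {ι : Type} [Fintype ι] (c : ι → ℂ)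
    (A B e : Matrix m m ℂ) (x y : ι → m → m → R) (w : m → m → R)
    (h : ∀ i p q j, ∑ t, c t • (x t i p * y t q j) = e p q • w i j) (i p q j : m) :
    ∑ t, c t • (conjEntries A B (x t) i p * conjEntries A B (y t) q j) =
      (Bᵀ * e * Aᵀ) p q • conjEntries A B w i j := by
  rw [sum_smul_conjEntries_mul_conjEntries]
  simp only [h]
  simp only [Fintype.sum_prod_type, conjEntries, Finset.smul_sum]
  refine Finset.sum_congr rfl fun i' _ => ?_
  have : ∀ p', ∑ q', ∑ j', (A i i' * B p' p * (A q q' * B j' j)) • e p' q' • w i' j' =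
      ∑ j', ∑ q', (A i i' * B p' p * (A q q' * B j' j)) • e p' q' • w i' j' := fun p' =>
    Finset.sum_comm
  simp only [this]
  rw [Finset.sum_comm]
  refine Finset.sum_congr rfl fun j' _ => ?_
  rw [Finset.sum_comm, mul_apply, Finset.sum_smul]
  refine Finset.sum_congr rfl fun q' _ => ?_
  rw [mul_apply, Finset.sum_mul, Finset.sum_smul]
  refine Finset.sum_congr rfl fun p' _ => ?_
  rw [smul_smul, smul_smul]
  congr 1
  simp only [transpose_apply]
  ring

end conj

section relations
variable {D D' : BlockSizes} (E : Multimatrix D) (F : Multimatrix D')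

/-- The image of a generator in the universal algebra. -/
def univX (a : Fin D.n) (i j : Fin (D.d a)) (b : Fin D'.n) (k l : Fin (D'.d b)) : UnivAlg E F :=
  RingQuot.mkAlgHom ℂ (UnivRel E F) (genX a i j b k l)

lemma univX_mul_same (c : Fin D.n) (r s : Fin (D.d c)) (b : Fin D'.n) (i j k l : Fin (D'.d b)) :
    ∑ q, univX E F c r q b i j * univX E F c q s b k l =
      if j = k then univX E F c r s b i l else 0 := by
  have := RingQuot.mkAlgHom_rel ℂ (UnivRel.mul_same (E := E) (F := F) c r s b i j k l)
  simpa only [univX, map_sum, map_mul, map_zero, apply_ite (RingQuot.mkAlgHom ℂ (UnivRel E F))] using this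

lemma univX_mul_ne (c : Fin D.n) (r s : Fin (D.d c)) (b b' : Fin D'.n) (hb : b ≠ b')
    (i j : Fin (D'.d b)) (k l : Fin (D'.d b')) :
    ∑ q, univX E F c r q b i j * univX E F c q s b' k l = 0 := by
  have := RingQuot.mkAlgHom_rel ℂ (UnivRel.mul_ne (E := E) (F := F) c r s b b' hb i j k l)
  simpa only [univX, map_sum, map_mul, map_zero] using this

lemma univX_unit (a : Fin D.n) (i j : Fin (D.d a)) :
    ∑ b : Fin D'.n, ∑ k, univX E F a i j b k k = if i = j then 1 else 0 := by
  have := RingQuot.mkAlgHom_rel ℂ (UnivRel.unit (E := E) (F := F) a i j)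
  simpa only [univX, map_sum, map_zero, map_one, apply_ite (RingQuot.mkAlgHom ℂ (UnivRel E F))] using this

lemma univX_counit (b : Fin D'.n) (i j : Fin (D'.d b)) :
    ∑ a : Fin D.n, ∑ k, ∑ l, (E⁻¹ a) k l • univX E F a k l b i j =
      algebraMap ℂ _ ((F⁻¹ b) i j) := by
  have := RingQuot.mkAlgHom_rel ℂ (UnivRel.counit (E := E) (F := F) b i j)
  simpa only [univX, map_sum, map_smul, AlgHom.commutes] using this

lemma univX_comul_same (a : Fin D.n) (i p q j : Fin (D.d a)) (b : Fin D'.n) (k l : Fin (D'.d b)) :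
    ∑ r, ∑ s, F b r s • (univX E F a i p b k r * univX E F a q j b s l) =
      E a p q • univX E F a i j b k l := by
  have := RingQuot.mkAlgHom_rel ℂ (UnivRel.comul_same (E := E) (F := F) a i p q j b k l)
  simpa only [univX, map_sum, map_smul, map_mul] using this

lemma univX_comul_ne (a c : Fin D.n) (hac : a ≠ c) (i p : Fin (D.d a)) (q j : Fin (D.d c))
    (b : Fin D'.n) (k l : Fin (D'.d b)) :
    ∑ r, ∑ s, F b r s • (univX E F a i p b k r * univX E F c q j b s l) = 0 := by
  have := RingQuot.mkAlgHom_rel ℂ (UnivRel.comul_ne (E := E) (F := F) a c hac i p q j b k l)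
  simpa only [univX, map_sum, map_smul, map_mul, map_zero] using this

/-- Conjugating the first multimatrix does not affect nontriviality. -/
theorem nontrivial_univAlg_of_conj_left (P : Multimatrix D)
    (h : Nontrivial (UnivAlg (P * E * P⁻¹) F)) : Nontrivial (UnivAlg E F) := by
  -- The transposes reflect that `E` occurs with the inner indices in `comul` and `E⁻¹` is
  -- contracted against both upper indices in `counit`; `hE` and `hE'` are the two resulting
  -- requirements.
  let A : ∀ a, Matrix (Fin (D.d a)) (Fin (D.d a)) ℂ := fun a => (P a).valᵀ
  let B : ∀ a, Matrix (Fin (D.d a)) (Fin (D.d a)) ℂ := fun a => ((P a)⁻¹).valᵀ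
  have hAB : ∀ a, A a * B a = 1 := fun a => by
    rw [← transpose_mul, ← Units.val_mul, inv_mul_cancel, Units.val_one, transpose_one]
  have hBA : ∀ a, B a * A a = 1 := fun a => mul_eq_one_comm.1 (hAB a)
  have hE : ∀ a, (B a)ᵀ * ((P * E * P⁻¹) a).val * (A a)ᵀ = (E a).val := fun a => by
    simp only [A, B, transpose_transpose, ← Units.val_mul]
    congr 1
    simp only [Pi.mul_apply, Pi.inv_apply]
    group
  have hE' : ∀ a, (A a)ᵀ * (E⁻¹ a).val * (B a)ᵀ = ((P * E * P⁻¹)⁻¹ a).val := fun a => by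
    simp only [A, B, transpose_transpose, ← Units.val_mul]
    congr 1
    simp only [Pi.mul_apply, Pi.inv_apply]
    group
  let Y : GenLabel D D' → UnivAlg (P * E * P⁻¹) F := fun x =>
    conjEntries (A x.a) (B x.a) (fun i j => univX (P * E * P⁻¹) F x.a i j x.b x.k x.l) x.i x.j
  have hY : ∀ a i j b k l, FreeAlgebra.lift ℂ Y (genX a i j b k l) = conjEntries (A a) (B a)
      (fun i j => univX (P * E * P⁻¹) F a i j b k l) i j := fun a i j b k l =>
    FreeAlgebra.lift_ι_apply _ _
  refine (RingQuot.liftAlgHom ℂ (s := UnivRel E F)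
    ⟨FreeAlgebra.lift ℂ Y, fun x y hxy => ?_⟩).toRingHom.domain_nontrivial
  induction hxy with
  | mul_same c r s b i j k l =>
    simp only [map_sum, map_mul, hY]
    rw [sum_conjEntries_mul (hBA c)]
    simp only [univX_mul_same]
    split_ifs
    · rw [hY]
    · rw [map_zero, conjEntries_zero]
  | mul_ne c r s b b' hb i j k l =>
    simp only [map_sum, map_mul, hY]
    rw [sum_conjEntries_mul (hBA c)]
    simp only [univX_mul_ne _ _ _ _ _ _ _ hb, conjEntries_zero, map_zero]
  | unit a i j =>
    have h1 := conjEntries_ite (R := UnivAlg (P * E * P⁻¹) F) (hAB a) i j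
    simp only [← univX_unit (P * E * P⁻¹) F a] at h1
    simp only [map_sum, hY, apply_ite (FreeAlgebra.lift ℂ Y), map_one, map_zero]
    rw [← univX_unit (P * E * P⁻¹) F a, ← h1]
    simp only [conjEntries_sum]
  | counit b i j =>
    simp only [map_sum, map_smul, hY, AlgHom.commutes]
    rw [← univX_counit (P * E * P⁻¹) F b]
    refine Finset.sum_congr rfl fun a _ => ?_
    rw [sum_smul_conjEntries, hE']
  | comul_same a i p q j b k l =>
    simp only [map_sum, map_smul, map_mul, hY]
    have h1 := sum_smul_conjEntries_mul_conjEntries_of_eq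
      (fun t : Fin (D'.d b) × Fin (D'.d b) => F b t.1 t.2) (A a) (B a) ((P * E * P⁻¹) a).val
      (fun t i p => univX (P * E * P⁻¹) F a i p b k t.1)
      (fun t q j => univX (P * E * P⁻¹) F a q j b t.2 l)
      (fun i j => univX (P * E * P⁻¹) F a i j b k l)
      (fun i p q j => by
        rw [Fintype.sum_prod_type]
        exact univX_comul_same _ _ a i p q j b k l) i p q j
    rw [Fintype.sum_prod_type, hE] at h1
    exact h1
  | comul_ne a c hac i p q j b k l =>
    simp only [map_sum, map_smul, map_mul, hY, map_zero]
    have h1 := sum_smul_conjEntries_mul_conjEntries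
      (fun t : Fin (D'.d b) × Fin (D'.d b) => F b t.1 t.2) (A a) (B a) (A c) (B c)
      (fun t i p => univX (P * E * P⁻¹) F a i p b k t.1)
      (fun t q j => univX (P * E * P⁻¹) F c q j b t.2 l) i p q j
    simp only [Fintype.sum_prod_type, univX_comul_ne _ _ a c hac, smul_zero,
      Finset.sum_const_zero] at h1
    exact h1

/-- Conjugating the second multimatrix does not affect nontriviality. -/
theorem nontrivial_univAlg_of_conj_right (P : Multimatrix D')
    (h : Nontrivial (UnivAlg E (P * F * P⁻¹))) : Nontrivial (UnivAlg E F) := by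
  let A : ∀ a, Matrix (Fin (D'.d a)) (Fin (D'.d a)) ℂ := fun a => ((P a)⁻¹).val
  let B : ∀ a, Matrix (Fin (D'.d a)) (Fin (D'.d a)) ℂ := fun a => (P a).val
  have hAB : ∀ a, A a * B a = 1 := fun a => by
    rw [← Units.val_mul, inv_mul_cancel, Units.val_one]
  have hBA : ∀ a, B a * A a = 1 := fun a => mul_eq_one_comm.1 (hAB a)
  have hF : ∀ a, B a * (F a).val * A a = ((P * F * P⁻¹) a).val := fun a => by
    simp only [A, B, ← Units.val_mul]
    rfl
  have hF' : ∀ a, A a * ((P * F * P⁻¹)⁻¹ a).val * B a = (F⁻¹ a).val := fun a => by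
    simp only [A, B, ← Units.val_mul]
    congr 1
    simp only [Pi.mul_apply, Pi.inv_apply]
    group
  let Y : GenLabel D D' → UnivAlg E (P * F * P⁻¹) := fun x =>
    conjEntries (A x.b) (B x.b) (fun k l => univX E (P * F * P⁻¹) x.a x.i x.j x.b k l) x.k x.l
  have hY : ∀ a i j b k l, FreeAlgebra.lift ℂ Y (genX a i j b k l) = conjEntries (A b) (B b)
      (fun k l => univX E (P * F * P⁻¹) a i j b k l) k l := fun a i j b k l =>
    FreeAlgebra.lift_ι_apply _ _
  refine (RingQuot.liftAlgHom ℂ (s := UnivRel E F)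
    ⟨FreeAlgebra.lift ℂ Y, fun x y hxy => ?_⟩).toRingHom.domain_nontrivial
  induction hxy with
  | mul_same c r s b i j k l =>
    simp only [map_sum, map_mul, hY]
    have h1 := sum_smul_conjEntries_mul_conjEntries_of_eq
      (fun _ : Fin (D.d c) => 1) (A b) (B b) 1
      (fun q i j => univX E (P * F * P⁻¹) c r q b i j)
      (fun q k l => univX E (P * F * P⁻¹) c q s b k l)
      (fun i l => univX E (P * F * P⁻¹) c r s b i l)
      (fun i j k l => by
        simp only [one_smul, univX_mul_same, one_apply, ite_smul, zero_smul]) i j k l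
    simp only [one_smul] at h1
    rw [h1, Matrix.mul_one, ← transpose_mul, hAB, transpose_one, one_apply]
    split_ifs
    · rw [one_smul, hY]
    · rw [zero_smul, map_zero]
  | mul_ne c r s b b' hb i j k l =>
    simp only [map_sum, map_mul, hY, map_zero]
    have h1 := sum_smul_conjEntries_mul_conjEntries
      (fun _ : Fin (D.d c) => 1) (A b) (B b) (A b') (B b')
      (fun q i j => univX E (P * F * P⁻¹) c r q b i j)
      (fun q k l => univX E (P * F * P⁻¹) c q s b' k l) i j k l
    simpa only [one_smul, univX_mul_ne _ _ _ _ _ _ _ hb, smul_zero,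
      Finset.sum_const_zero] using h1
  | unit a i j =>
    simp only [map_sum, hY, apply_ite (FreeAlgebra.lift ℂ Y), map_one, map_zero]
    rw [← univX_unit E (P * F * P⁻¹) a]
    refine Finset.sum_congr rfl fun b _ => ?_
    have h1 := sum_smul_conjEntries (A b) (B b) 1
      (fun k l => univX E (P * F * P⁻¹) a i j b k l)
    simpa [← transpose_mul, hBA, one_apply, ite_smul] using h1
  | counit b i j =>
    simp only [map_sum, map_smul, hY, AlgHom.commutes]
    rw [← hF', ← conjEntries_algebraMap]
    simp only [← univX_counit, conjEntries_sum, conjEntries_smul]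
  | comul_same a i p q j b k l =>
    simp only [map_sum, map_smul, map_mul, hY]
    rw [sum_smul_conjEntries_mul, hF]
    simp only [univX_comul_same, conjEntries_smul]
  | comul_ne a c hac i p q j b k l =>
    simp only [map_sum, map_smul, map_mul, hY, map_zero]
    rw [sum_smul_conjEntries_mul, hF]
    simp only [univX_comul_ne _ _ a c hac, conjEntries_zero]

end relations

/-- Every complex matrix of size at least two is conjugate to one with an off-diagonal zero. -/
lemma exists_conj_apply_eq_zero {d : ℕ} (hd : 1 < d) (M : Matrix (Fin d) (Fin d) ℂ) :
    ∃ (P : GL (Fin d) ℂ) (i j : Fin d), i ≠ j ∧ (P.val * M * P⁻¹.val) i j = 0 := by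
  let a : Fin d := ⟨0, by omega⟩
  let p : Fin d := ⟨1, hd⟩
  have hap : a ≠ p := by simp [a, p]
  by_cases h0 : M p a = 0
  · exact ⟨1, p, a, hap.symm, by simpa using h0⟩
  -- Conjugating by the transvection `1 + c e_{ap}` turns the entry `(a, p)` into this quadratic
  -- polynomial in `c`, which has a complex root.
  obtain ⟨c, hc⟩ := exists_quadratic_eq_zero (a := -M p a) (b := M p p - M a a) (c := M a p)
    (neg_ne_zero.2 h0) (by
      obtain ⟨s, hs⟩ := IsAlgClosed.exists_pow_nat_eq
        (discrim (-M p a) (M p p - M a a) (M a p)) (n := 2) (by norm_num)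
      exact ⟨s, by rw [← hs, sq]⟩)
  refine ⟨⟨transvection a p c, transvection a p (-c), ?_, ?_⟩, a, p, hap, ?_⟩
  · rw [transvection_mul_transvection_same _ _ hap, add_neg_cancel, transvection_zero]
  · rw [transvection_mul_transvection_same _ _ hap, neg_add_cancel, transvection_zero]
  · change (transvection a p c * M * transvection a p (-c)) a p = 0
    rw [mul_transvection_apply_same, transvection_mul_apply_same, transvection_mul_apply_same]
    rw [← hc]
    ring

end

theorem mainTheorem7 {D D' : BlockSizes} (E : Multimatrix D) (F : Multimatrix D')
    (hE : 1 < D.largest) (hF : 1 < D'.largest)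
    (hTr : Multimatrix.Tr E⁻¹ = Multimatrix.Tr F⁻¹)
    (htr : ∀ (a : Fin D.n) (b : Fin D'.n),
      (E a : Matrix (Fin (D.d a)) (Fin (D.d a)) ℂ).trace =
        (F b : Matrix (Fin (D'.d b)) (Fin (D'.d b)) ℂ).trace) :
    Nontrivial (UnivAlg E F) := by
  obtain ⟨P, i, j, hij, hP⟩ := exists_conj_apply_eq_zero hE
    (E⁻¹ ⟨D.n - 1, Nat.sub_lt D.n_pos Nat.one_pos⟩).val
  -- The indices are named in reverse order because the zero of `F` is needed at `(j', i')`, whereas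
  -- that of `E⁻¹` is needed at `(i, j)`.
  obtain ⟨P', j', i', hij', hP'⟩ := exists_conj_apply_eq_zero hF
    (F ⟨D'.n - 1, Nat.sub_lt D'.n_pos Nat.one_pos⟩).val
  let S : Multimatrix D := Function.update 1 _ P
  let S' : Multimatrix D' := Function.update 1 _ P'
  have hconj : ∀ {n : ℕ} (S M : GL (Fin n) ℂ), (S * M * S⁻¹).val.trace = M.val.trace :=
    fun S M => by
      rw [Units.val_mul, Units.val_mul, Matrix.trace_units_conj]
  have hinv : ∀ {D₀ : BlockSizes} (S M : Multimatrix D₀), (S * M * S⁻¹)⁻¹ = S * M⁻¹ * S⁻¹ :=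
    fun S M => by group
  have hTrconj : ∀ {D₀ : BlockSizes} (S M : Multimatrix D₀),
      Multimatrix.Tr (S * M * S⁻¹) = Multimatrix.Tr M := fun S M =>
    Finset.sum_congr rfl fun a _ => hconj (S a) (M a)
  refine nontrivial_univAlg_of_conj_left E F S (nontrivial_univAlg_of_conj_right _ F S' ?_)
  refine nontrivial_univAlg_of_apply_eq_zero _ _ ?_ ?_ _ i j hij ?_ _ i' j' hij'.symm ?_
  · rw [hinv, hinv, hTrconj, hTrconj, hTr]
  · intro a b
    exact (hconj (S a) (E a)).trans ((htr a b).trans (hconj (S' b) (F b)).symm)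
  · rw [hinv]
    change (S _ * E⁻¹ _ * (S _)⁻¹).val i j = 0
    rw [show S _ = P from Function.update_self _ _ _]
    exact hP
  · change (S' _ * F _ * (S' _)⁻¹).val j' i' = 0
    rw [show S' _ = P' from Function.update_self _ _ _]
    exact hP'
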